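/- Let $\mathcal{E}$ be a Grothendieck topos with a point, i.e. with a functor $F:\mathcal{E}\to\mathrm{Set}$ that preserves finite limits and has a right adjoint (the inverse image of the point). Let $\mathrm{Rel}(\mathcal{E})$ be the category with the objects of $\mathcal{E}$ and with relations $R\rightarrowtail X\times Y$ as arrows $X\to Y$, and let $T=\mathrm{Rel}(F):\mathrm{Rel}(\mathcal{E})\to\mathrm{Rel}(\mathrm{Set})$, $TX=FX$, $TR=FR\subseteq FX\times FY$, be the extension of $F$. A *$\lozenge$-cone* with values in a sup-lattice $H$ is a family of maps $\lambda_X:TX\times TX\to H$ ($X\in\mathcal{E}$) such that, for all $R:X\to Y$ in $\mathrm{Rel}(\mathcal{E})$, $a\in TX$ and $b\in TY$, $$\bigvee_{(y,b)\in TR}\lambda_X(a,y)=\bigvee_{(a,x)\in TR}\lambda_Y(x,b).$$ The Tannakian coend $End^\vee(T)=\int^X TX\otimes (TX)^\wedge$ is the vertex of the universal $\lozenge$-cone in the category $s\ell$ of sup-lattices and sup-preserving maps. A *$\rhd$-cone of $\ell$-bijections* with values in a locale $G$ is a family of maps $\lambda_X:FX\times FX\to G$ such that $\lambda_X(a,b)\le\lambda_Y(F(f)(a),F(f)(b))$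 for all $f:X\to Y$ in $\mathcal{E}$, and such that, for every $X$, $\bigvee_y\lambda_X(a,y)=1$ and $\bigvee_x\lambda_X(x,b)=1$ for all $a,b$, while $\lambda_X(x,b_1)\wedge\lambda_X(x,b_2)=0$ for $b_1\ne b_2$ and $\lambda_X(a_1,y)\wedge\lambda_X(a_2,y)=0$ for $a_1\neq a_2$. The locale $Aut(F)$ is the vertex of the universal $\rhd$-cone of $\ell$-bijections in the category of locales (with frame homomorphisms as arrows). A localic group is regarded as a Hopf algebra in the symmetric monoidal category $s\ell$ which is a locale, i.e. whose underlying sup-lattice is a locale and whose multiplication and unit are $\wedge$ and $1$. **Theorem.** Both $End^\vee(T)$ and $Aut(F)$ exist. There is a unique Hopf algebra structure on $End^\vee(T)$ in $s\ell$ such that, writing $[X,a,b]=\lambda_X(a,b)$, $$[X,a,a']\cdot[Y,b,b']=[X\times Y,(a,b),(a',b')],\qquad u=[1,*,*],$$ $$w[X,a,b]=\bigvee_{x\in FX}[X,a,x]\otimes[X,x,b],\qquad \varepsilon[X,a,b]=\delta_{a=b},\qquad \iota[X,a,b]=[X,b,a],$$ and there is a unique localic group structure on $Aut(F)$ whose comultiplication,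 counit and antipode are given on the elements $\lambda_X(a,b)$ by the formulas of the second line. With these structures, $End^\vee(T)$ is a locale and a localic group (its multiplication is $\wedge$ and its unit is $1$), and there is a unique isomorphism of localic groups $End^\vee(T)\cong Aut(F)$ commuting with the cone maps $\lambda_X$. -/

import Mathlib

open CategoryTheory CategoryTheory.Limits MonoidalCategory
universe u v w

/-! ## Grothendieck topoi -/

/-- A (locally small) category is a Grothendieck topos if it is equivalent to the category of
sheaves of sets on a small site. -/
class IsGrothendieckTopos (E : Type w) [Category.{u} E] : Prop where
  /-- There is a small site of definition. -/
  exists_site : ∃ (C : Type u) (_ : SmallCategory C) (J : GrothendieckTopology C),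
    Nonempty (E ≌ Sheaf J (Type u))

namespace IsGrothendieckTopos

theorem sheaf_epi_stable {C : Type u} [SmallCategory C] (J : GrothendieckTopology C)
    {P X Y Z : Sheaf J (Type u)} {fst : P ⟶ X} {snd : P ⟶ Y} {f : X ⟶ Z} {g : Y ⟶ Z}
    (h : IsPullback fst snd f g) [Epi f] : Epi snd := by
  rw [← Sheaf.isLocallySurjective_iff_epi]
  have hf : Sheaf.IsLocallySurjective f := (Sheaf.isLocallySurjective_iff_epi f).2 inferInstance
  refine ⟨fun {U} y => ?_⟩
  refine J.superset_covering ?_ (Presheaf.imageSieve_mem J f.hom ((g.hom.app (.op U)) y))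
  rintro V i ⟨x, hx⟩
  have hp := h.map (sheafToPresheaf J (Type u) ⋙ (evaluation _ _).obj (.op V))
  obtain ⟨p, hp1, hp2⟩ := Types.exists_of_isPullback hp x (Y.obj.map i.op y)
    (hx.trans (NatTrans.naturality_apply g.hom i.op y).symm)
  exact ⟨p, hp2⟩

variable (E : Type w) [Category.{u} E] [IsGrothendieckTopos E]

/-- Every Grothendieck topos is a regular category. -/
instance regular : Regular E := by
  obtain ⟨C, _, J, ⟨e⟩⟩ := exists_site (E := E)
  have hl : HasFiniteLimits E := ⟨fun _ _ _ => Adjunction.hasLimitsOfShape_of_equivalence e.functor⟩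
  have hc : HasFiniteColimits E :=
    ⟨fun _ _ _ => Adjunction.hasColimitsOfShape_of_equivalence e.functor⟩
  refine { hl with
    hasCoequalizer_of_isKernelPair := fun _ => inferInstance
    regularEpiIsStableUnderBaseChange := ⟨?_⟩ }
  intro X Y Y' S f g f' g' sq hg
  have : IsRegularEpi g := hg
  have : Epi g := inferInstance
  have h1 := sheaf_epi_stable J (sq.map e.functor)
  have : EffectiveEpi (e.functor.map g') := by
    rw [← isRegularEpi_iff_effectiveEpi]
    apply IsRegularEpiCategory.regularEpiOfEpi
  have := e.functor.effectiveEpi_of_map g' this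
  exact (isRegularEpi_iff_effectiveEpi g').2 this

end IsGrothendieckTopos

/-! ## The category of relations of a regular category -/

noncomputable section Relations

variable (E : Type w) [Category.{v} E]

/-- The objects of the category `Rel(E)` of relations in `E`: they are those of `E`. -/
structure RelOf where
  /-- The object of `E`, seen as an object of `Rel(E)`. -/
  of ::
  /-- The underlying object of `E`. -/
  obj : E

namespace RelOf

variable {E}

/-- An arrow `X ⟶ Y` of `Rel(E)` is a relation `R ↣ X × Y`, that is, a subobject of the product. -/
@[ext]
structure Hom [HasFiniteLimits E] (X Y : RelOf E) where
  /-- The underlying subobject. -/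
  sub : Subobject (X.obj ⨯ Y.obj)

namespace Hom

section
variable [HasFiniteLimits E] {X Y Z : RelOf E}

/-- The first leg `R ⟶ X` of the span given by a relation `R`. -/
def fst (R : Hom X Y) : (R.sub : E) ⟶ X.obj := R.sub.arrow ≫ prod.fst

/-- The second leg `R ⟶ Y` of the span given by a relation `R`. -/
def snd (R : Hom X Y) : (R.sub : E) ⟶ Y.obj := R.sub.arrow ≫ prod.snd

/-- The generalised elements `x`, `y` are related by `R`. -/
def Rel (R : Hom X Y) {T : E} (x : T ⟶ X.obj) (y : T ⟶ Y.obj) : Prop :=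
  ∃ r : T ⟶ (R.sub : E), r ≫ R.fst = x ∧ r ≫ R.snd = y

theorem Rel.precomp {R : Hom X Y} {T T' : E} {x : T ⟶ X.obj} {y : T ⟶ Y.obj} (h : R.Rel x y)
    (e : T' ⟶ T) : R.Rel (e ≫ x) (e ≫ y) := by
  obtain ⟨r, rfl, rfl⟩ := h
  exact ⟨e ≫ r, by simp, by simp⟩

theorem rel_self (R : Hom X Y) : R.Rel R.fst R.snd := ⟨𝟙 _, by simp, by simp⟩

theorem le_of_rel {R S : Hom X Y} (h : S.Rel R.fst R.snd) : R.sub ≤ S.sub := by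
  obtain ⟨r, h1, h2⟩ := h
  refine Subobject.le_of_comm r ?_
  ext
  · simpa [fst] using h1
  · simpa [snd] using h2

theorem ext_of_rel {R S : Hom X Y}
    (h : ∀ {T : E} (x : T ⟶ X.obj) (y : T ⟶ Y.obj), R.Rel x y ↔ S.Rel x y) : R = S :=
  Hom.ext (le_antisymm (le_of_rel ((h _ _).1 R.rel_self)) (le_of_rel ((h _ _).2 S.rel_self)))

theorem Rel.of_strongEpi {R : Hom X Y} {T T' : E} {x : T ⟶ X.obj} {y : T ⟶ Y.obj}
    (e : T' ⟶ T) [StrongEpi e] (h : R.Rel (e ≫ x) (e ≫ y)) : R.Rel x y := by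
  obtain ⟨r, h1, h2⟩ := h
  have sq : CommSq r e R.sub.arrow (prod.lift x y) := ⟨by
    ext
    · simpa [fst, prod.lift_fst] using h1
    · simpa [snd, prod.lift_snd] using h2⟩
  have hl := sq.fac_right
  exact ⟨sq.lift, by rw [fst, ← Category.assoc, hl, prod.lift_fst],
    by rw [snd, ← Category.assoc, hl, prod.lift_snd]⟩

variable (X) in
/-- The identity relation is the diagonal. -/
def id : Hom X X := ⟨Subobject.mk (diag X.obj)⟩

theorem id_rel_iff {T : E} (x y : T ⟶ X.obj) : (Hom.id X).Rel x y ↔ x = y := by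
  constructor
  · rintro ⟨r, rfl, rfl⟩
    have h : (Subobject.mk (diag X.obj)).arrow ≫ prod.fst
        = (Subobject.mk (diag X.obj)).arrow ≫ prod.snd := by
      simp [← Subobject.underlyingIso_hom_comp_eq_mk, prod.lift_fst, prod.lift_snd]
    exact congrArg (r ≫ ·) h
  · rintro rfl
    exact ⟨x ≫ (Subobject.underlyingIso (diag X.obj)).inv, by simp [fst, id, prod.lift_fst],
      by simp [snd, id, prod.lift_snd]⟩

end

variable [Regular E] {X Y Z W : RelOf E}

/-- Composition of relations: the image in `X × Z` of the pullback of `R` and `S` over `Y`. -/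
def comp (R : Hom X Y) (S : Hom Y Z) : Hom X Z :=
  ⟨imageSubobject (prod.lift (pullback.fst R.snd S.fst ≫ R.fst) (pullback.snd R.snd S.fst ≫ S.snd))⟩

theorem exists_cover (R : Hom X Y) (S : Hom Y Z) :
    ∃ e : pullback R.snd S.fst ⟶ ((comp R S).sub : E), IsRegularEpi e ∧
      e ≫ (comp R S).fst = pullback.fst R.snd S.fst ≫ R.fst ∧
      e ≫ (comp R S).snd = pullback.snd R.snd S.fst ≫ S.snd := by
  refine ⟨factorThruImageSubobject _, ?_, ?_, ?_⟩
  · have h : StrongEpi (factorThruImageSubobject (prod.lift (pullback.fst R.snd S.fst ≫ R.fst)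
      (pullback.snd R.snd S.fst ≫ S.snd))) := by
      unfold factorThruImageSubobject; infer_instance
    have h' := @Regular.isRegularEpi_of_extremalEpi _ _ _ _ _ _ (@instExtremalEpiOfStrongEpi _ _ _ _ _ h)
    exact h'
  · exact (imageSubobject_arrow_comp_assoc _ _).trans (prod.lift_fst _ _)
  · exact (imageSubobject_arrow_comp_assoc _ _).trans (prod.lift_snd _ _)

theorem comp_rel_iff (R : Hom X Y) (S : Hom Y Z) {T : E} (x : T ⟶ X.obj) (z : T ⟶ Z.obj) :
    (comp R S).Rel x z ↔ ∃ (T' : E) (e : T' ⟶ T) (_ : IsRegularEpi e) (y : T' ⟶ Y.obj),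
      R.Rel (e ≫ x) y ∧ S.Rel y (e ≫ z) := by
  obtain ⟨q, hq, h1, h2⟩ := exists_cover R S
  constructor
  · rintro ⟨t, rfl, rfl⟩
    refine ⟨_, pullback.fst t q, inferInstance,
      pullback.snd t q ≫ pullback.fst _ _ ≫ R.snd, ?_, ?_⟩
    · refine ⟨pullback.snd t q ≫ pullback.fst _ _, ?_, by simp⟩
      rw [← Category.assoc (pullback.fst t q), pullback.condition]
      simp [h1]
    · refine ⟨pullback.snd t q ≫ pullback.snd _ _, by simp [pullback.condition], ?_⟩
      rw [← Category.assoc (pullback.fst t q), pullback.condition]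
      simp [h2]
  · rintro ⟨T', e, he, y, ⟨r, hr1, rfl⟩, s, hs1, hs2⟩
    refine Rel.of_strongEpi e ⟨pullback.lift r s hs1.symm ≫ q, ?_, ?_⟩
    · simp [h1, hr1, pullback.lift_fst_assoc]
    · simp [h2, hs2, pullback.lift_snd_assoc]

theorem id_comp' (R : Hom X Y) : comp (Hom.id X) R = R := by
  refine ext_of_rel fun x y => ?_
  rw [comp_rel_iff]
  constructor
  · rintro ⟨T', e, he, x', h, h'⟩
    rw [id_rel_iff] at h
    subst h
    exact h'.of_strongEpi e
  · exact fun h => ⟨_, 𝟙 _, inferInstance, x, by simp [id_rel_iff], by simpa⟩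

theorem comp_id' (R : Hom X Y) : comp R (Hom.id Y) = R := by
  refine ext_of_rel fun x y => ?_
  rw [comp_rel_iff]
  constructor
  · rintro ⟨T', e, he, x', h, h'⟩
    rw [id_rel_iff] at h'
    subst h'
    exact h.of_strongEpi e
  · exact fun h => ⟨_, 𝟙 _, inferInstance, y, by simpa, by simp [id_rel_iff]⟩

theorem assoc' (R : Hom X Y) (S : Hom Y Z) (U : Hom Z W) :
    comp (comp R S) U = comp R (comp S U) := by
  refine ext_of_rel fun x w => ?_
  constructor <;> rw [comp_rel_iff]
  · rintro ⟨T₁, e, he, z, h, h'⟩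
    obtain ⟨T₂, e', he', y, h₁, h₂⟩ := (comp_rel_iff _ _ _ _).1 h
    refine Rel.of_strongEpi e (Rel.of_strongEpi e' ?_)
    rw [comp_rel_iff]
    refine ⟨_, 𝟙 _, inferInstance, y, by simpa using h₁, ?_⟩
    rw [comp_rel_iff]
    exact ⟨_, 𝟙 _, inferInstance, e' ≫ z, by simpa using h₂, by simpa using h'.precomp e'⟩
  · rintro ⟨T₁, e, he, y, h, h'⟩
    obtain ⟨T₂, e', he', z, h₁, h₂⟩ := (comp_rel_iff _ _ _ _).1 h'
    refine Rel.of_strongEpi e (Rel.of_strongEpi e' ?_)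
    rw [comp_rel_iff]
    refine ⟨_, 𝟙 _, inferInstance, z, ?_, by simpa using h₂⟩
    rw [comp_rel_iff]
    exact ⟨_, 𝟙 _, inferInstance, e' ≫ y, by simpa using h.precomp e', by simpa using h₁⟩

end Hom

instance [Regular E] : Category (RelOf E) where
  Hom := Hom
  id := Hom.id
  comp := Hom.comp
  id_comp := Hom.id_comp'
  comp_id := Hom.comp_id'
  assoc := Hom.assoc'

theorem comp_eq [Regular E] {X Y Z : RelOf E} (R : X ⟶ Y) (S : Y ⟶ Z) :
    Hom.comp R S = R ≫ S := rfl

end RelOf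

variable {E}

/-- The relation `F R ⊆ F X × F Y` that `F` makes out of a relation `R ↣ X × Y`. -/
def relMap [HasFiniteLimits E] (F : E ⥤ Type u) {X Y : RelOf E} (R : RelOf.Hom X Y) :
    SetRel (F.obj X.obj) (F.obj Y.obj) :=
  {p | ∃ r : F.obj (R.sub : E), F.map R.fst r = p.1 ∧ F.map R.snd r = p.2}

/-- The functor `T = Rel(F) : Rel(E) ⥤ Rel` which extends `F : E ⥤ Ens`. -/
def relFunctor [Regular E] (F : E ⥤ Type u) [PreservesFiniteLimits F] [F.PreservesEpimorphisms] :
    RelOf E ⥤ RelCat.{u} where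
  obj X := F.obj X.obj
  map R := .ofRel (relMap F R)
  map_id X := by
    refine RelCat.Hom.ext _ _ (Set.ext fun ⟨a, b⟩ => ?_)
    have h := (RelOf.Hom.id_rel_iff _ _).1 (RelOf.Hom.id X).rel_self
    constructor
    · rintro ⟨r, h1, h2⟩
      change F.map (RelOf.Hom.id X).fst r = a at h1
      change F.map (RelOf.Hom.id X).snd r = b at h2
      rw [h, h2] at h1
      exact h1.symm
    · rintro (rfl : a = b)
      obtain ⟨r, hr1, hr2⟩ := (RelOf.Hom.id_rel_iff (𝟙 X.obj) (𝟙 X.obj)).2 rfl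
      refine ⟨F.map r a, ?_, ?_⟩
      · change F.map (RelOf.Hom.id X).fst (F.map r a) = a
        rw [← Functor.map_comp_apply, hr1, Functor.map_id_apply]
      · change F.map (RelOf.Hom.id X).snd (F.map r a) = a
        rw [← Functor.map_comp_apply, hr2, Functor.map_id_apply]
  map_comp {X Y Z} R S := by
    refine RelCat.Hom.ext _ _ (Set.ext fun ⟨a, c⟩ => ?_)
    obtain ⟨q, hq, h1, h2⟩ := RelOf.Hom.exists_cover R S
    have hp := (IsPullback.of_hasPullback R.snd S.fst).map F
    constructor
    · rintro ⟨t, ht1, ht2⟩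
      have hs : Epi (F.map q) := inferInstance
      obtain ⟨p, rfl⟩ := (epi_iff_surjective _).1 hs t
      change F.map (RelOf.Hom.comp R S).fst (F.map q p) = a at ht1
      change F.map (RelOf.Hom.comp R S).snd (F.map q p) = c at ht2
      rw [← Functor.map_comp_apply, h1, Functor.map_comp_apply] at ht1
      rw [← Functor.map_comp_apply, h2, Functor.map_comp_apply] at ht2
      refine ⟨F.map R.snd (F.map (pullback.fst R.snd S.fst) p), ⟨_, ht1, rfl⟩, ⟨_, ?_, ht2⟩⟩
      change F.map S.fst (F.map (pullback.snd R.snd S.fst) p) =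
        F.map R.snd (F.map (pullback.fst R.snd S.fst) p)
      rw [← Functor.map_comp_apply, ← pullback.condition, Functor.map_comp_apply]
    · rintro ⟨b, ⟨r, hr1, hr2⟩, s, hs1, hs2⟩
      obtain ⟨p, hp1, hp2⟩ := Types.exists_of_isPullback hp r s (hr2.trans hs1.symm)
      refine ⟨F.map q p, ?_, ?_⟩
      · change F.map (RelOf.Hom.comp R S).fst (F.map q p) = a
        rw [← Functor.map_comp_apply, h1, Functor.map_comp_apply, hp1]
        exact hr1
      · change F.map (RelOf.Hom.comp R S).snd (F.map q p) = c
        rw [← Functor.map_comp_apply, h2, Functor.map_comp_apply, hp2]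
        exact hs2

end Relations

noncomputable section SupLattices

/-! ## Sup-lattices -/

/-- A subset `U` of `A × B` is a bi-ideal if it is the set of pairs which are sent below a fixed
element by some bilinear map: for fixed `b` it is closed under suprema and downwards in the first
variable, and symmetrically. -/
structure IsBiIdeal {A B : Type u} [CompleteLattice A] [CompleteLattice B] (U : Set (A × B)) :
    Prop where
  sSup_left : ∀ (S : Set A) (b : B), (sSup S, b) ∈ U ↔ ∀ a ∈ S, (a, b) ∈ U
  sSup_right : ∀ (a : A) (S : Set B), (a, sSup S) ∈ U ↔ ∀ b ∈ S, (a, b) ∈ U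

/-- The tensor product `A ⊗ B` of two sup-lattices, as the lattice of the bi-ideals of `A × B`. -/
def SupTensor (A B : Type u) [CompleteLattice A] [CompleteLattice B] : Type u :=
  {U : Set (A × B) // IsBiIdeal U}

/-- A map of sup-lattices in two variables is bilinear if it preserves suprema in each variable. -/
structure IsBilinear {A B C : Type u} [CompleteLattice A] [CompleteLattice B] [CompleteLattice C]
    (f : A → B → C) : Prop where
  sSup_left : ∀ (S : Set A) (b : B), f (sSup S) b = ⨆ a ∈ S, f a b
  sSup_right : ∀ (a : A) (S : Set B), f a (sSup S) = ⨆ b ∈ S, f a b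

namespace SupTensor

variable {A B C D : Type u} [CompleteLattice A] [CompleteLattice B] [CompleteLattice C]
  [CompleteLattice D]

instance : PartialOrder (SupTensor A B) := inferInstanceAs (PartialOrder (Subtype _))

instance : InfSet (SupTensor A B) where
  sInf S := ⟨{p | ∀ U ∈ S, p ∈ U.1},
    ⟨fun T b => ⟨fun h a ha U hU => (U.2.sSup_left T b).1 (h U hU) a ha,
        fun h U hU => (U.2.sSup_left T b).2 fun a ha => h a ha U hU⟩,
      fun a T => ⟨fun h b hb U hU => (U.2.sSup_right a T).1 (h U hU) b hb,
        fun h U hU => (U.2.sSup_right a T).2 fun b hb => h b hb U hU⟩⟩⟩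

instance : CompleteLattice (SupTensor A B) :=
  completeLatticeOfInf _ fun _ =>
    ⟨fun U hU _ hp => hp U hU, fun _ hV _ hp _ hU => hV hU hp⟩

theorem _root_.IsBiIdeal.mono {U : Set (A × B)} (hU : IsBiIdeal U) {a a' : A} {b b' : B}
    (ha : a' ≤ a) (hb : b' ≤ b) (h : (a, b) ∈ U) : (a', b') ∈ U := by
  have h1 : (sSup {a', a}, b) ∈ U := by rwa [sSup_pair, sup_eq_right.2 ha]
  have h2 := (hU.sSup_left _ _).1 h1 a' (by simp)
  have h3 : (a', sSup {b', b}) ∈ U := by rwa [sSup_pair, sup_eq_right.2 hb]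
  exact (hU.sSup_right _ _).1 h3 b' (by simp)

/-- The element `a ⊗ b` of `A ⊗ B`. -/
def tmul (a : A) (b : B) : SupTensor A B := sInf {U | (a, b) ∈ U.1}

theorem tmul_le_iff {a : A} {b : B} {U : SupTensor A B} : (tmul a b) ≤ U ↔ (a, b) ∈ U.1 :=
  ⟨fun h => h (show (a, b) ∈ (sInf {U : SupTensor A B | (a, b) ∈ U.1}).1 from fun _ hV => hV),
    fun h => sInf_le h⟩

theorem isBilinear_tmul : IsBilinear (tmul : A → B → SupTensor A B) where
  sSup_left S b := eq_of_forall_ge_iff fun U => by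
    simp only [tmul_le_iff, iSup_le_iff, U.2.sSup_left]
  sSup_right a S := eq_of_forall_ge_iff fun U => by
    simp only [tmul_le_iff, iSup_le_iff, U.2.sSup_right]

theorem eq_iSup_tmul (U : SupTensor A B) : U = ⨆ p ∈ U.1, tmul p.1 p.2 :=
  le_antisymm (fun p hp => tmul_le_iff.1 (le_iSup₂ (f := fun (p : A × B) (_ : p ∈ U.1) =>
      tmul p.1 p.2) p hp))
    (iSup₂_le fun _ hp => tmul_le_iff.2 hp)

/-- Linear maps on `A ⊗ B` are determined by their values on the elements `a ⊗ b`. -/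
theorem hom_ext {f g : sSupHom (SupTensor A B) C} (h : ∀ a b, f (tmul a b) = g (tmul a b)) : f = g := by
  ext U
  rw [eq_iSup_tmul U]
  simp only [map_iSup, h]

/-- The linear map `A ⊗ B → C` induced by a bilinear map. -/
def lift (f : A → B → C) (hf : IsBilinear f) : sSupHom (SupTensor A B) C where
  toFun U := ⨆ p ∈ U.1, f p.1 p.2
  map_sSup' S := by
    have gc : GaloisConnection (fun U : SupTensor A B => ⨆ p ∈ U.1, f p.1 p.2)
        (fun c => ⟨{p | f p.1 p.2 ≤ c},
          ⟨fun S b => by simp [hf.sSup_left], fun a S => by simp [hf.sSup_right]⟩⟩) := fun U c =>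
      ⟨fun h p hp => (le_iSup₂ (f := fun (p : A × B) (_ : p ∈ U.1) => f p.1 p.2) p hp).trans h,
        fun h => iSup₂_le fun p hp => h hp⟩
    rw [gc.l_sSup, sSup_image]

@[simp] theorem lift_tmul (f : A → B → C) (hf : IsBilinear f) (a : A) (b : B) :
    lift f hf (tmul a b) = f a b := by
  refine le_antisymm (iSup₂_le fun p hp => ?_)
    (le_iSup₂ (f := fun (p : A × B) (_ : p ∈ (tmul a b).1) => f p.1 p.2) (a, b)
      (tmul_le_iff.1 le_rfl))
  exact hp ⟨{p | f p.1 p.2 ≤ f a b},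
    ⟨fun S b => by simp [hf.sSup_left], fun a S => by simp [hf.sSup_right]⟩⟩ le_rfl

theorem _root_.IsBilinear.comp {f : A → B → C} (hf : IsBilinear f) {A' B' : Type u}
    [CompleteLattice A'] [CompleteLattice B'] (g : sSupHom C D) (h : sSupHom A' A)
    (k : sSupHom B' B) : IsBilinear fun a b => g (f (h a) (k b)) where
  sSup_left S b := by rw [map_sSup, hf.sSup_left, iSup_image]; simp only [map_iSup]
  sSup_right a S := by rw [map_sSup, hf.sSup_right, iSup_image]; simp only [map_iSup]

theorem _root_.IsBilinear.flip {f : A → B → C} (hf : IsBilinear f) :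
    IsBilinear fun b a => f a b := ⟨fun S a => hf.sSup_right a S, fun b S => hf.sSup_left S b⟩

end SupTensor

/-- The category `sℓ` of sup-lattices. -/
structure SupLat where
  /-- The sup-lattice with the given underlying complete lattice. -/
  of ::
  /-- The underlying set. -/
  carrier : Type u
  [str : CompleteLattice carrier]

namespace SupLat

attribute [instance] str

instance : CoeSort SupLat (Type _) := ⟨carrier⟩

/-- The arrows of `sℓ` are the linear, that is, supremum preserving, maps. -/
@[ext]
structure Hom (A B : SupLat.{u}) where
  /-- The underlying supremum preserving map. -/
  hom : sSupHom A B

instance : Category SupLat.{u} where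
  Hom := Hom
  id A := ⟨sSupHom.id A⟩
  comp f g := ⟨g.hom.comp f.hom⟩

instance (A B : SupLat.{u}) : CoeFun (A ⟶ B) (fun _ => A → B) := ⟨fun f => f.hom⟩

@[ext] theorem hom_ext {A B : SupLat.{u}} {f g : A ⟶ B} (h : ∀ a, f a = g a) : f = g :=
  Hom.ext (sSupHom.ext h)

@[simp] theorem id_apply (A : SupLat.{u}) (a : A) : (𝟙 A : A ⟶ A) a = a := rfl
@[simp] theorem comp_apply {A B C : SupLat.{u}} (f : A ⟶ B) (g : B ⟶ C) (a : A) :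
  (f ≫ g) a = g (f a) := rfl


/-- The tensor product of sup-lattices. -/
def tens (A B : SupLat.{u}) : SupLat.{u} := of (SupTensor A B)

/-- The element `a ⊗ b` of the tensor product `A ⊗ B`. -/
def tmul {A B : SupLat.{u}} (a : A) (b : B) : tens A B := SupTensor.tmul a b

infixl:100 " ⊗ₛ " => SupLat.tmul

/-- The linear map out of a tensor product induced by a bilinear map. -/
def tensorDesc {A B C : SupLat.{u}} (f : A → B → C) (hf : IsBilinear f) : tens A B ⟶ C :=
  ⟨SupTensor.lift f hf⟩

@[simp] theorem tensorDesc_tmul {A B C : SupLat.{u}} (f : A → B → C) (hf : IsBilinear f) (a : A)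
    (b : B) : tensorDesc f hf (a ⊗ₛ b) = f a b := SupTensor.lift_tmul f hf a b

theorem tensor_ext {A B C : SupLat.{u}} {f g : tens A B ⟶ C}
    (h : ∀ a b, f (a ⊗ₛ b) = g (a ⊗ₛ b)) : f = g := Hom.ext (SupTensor.hom_ext h)

theorem isBilinear_tmul {A B : SupLat.{u}} : IsBilinear (tmul : A → B → tens A B) :=
  SupTensor.isBilinear_tmul

theorem eq_iSup_tmul {A B : SupLat.{u}} (U : tens A B) :
    ∃ S : Set (A × B), U = ⨆ p ∈ S, p.1 ⊗ₛ p.2 := ⟨_, SupTensor.eq_iSup_tmul U⟩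

theorem isBilinear_lift {A B C D : SupLat.{u}} (f : C → A → B → D) (hf : ∀ c, IsBilinear (f c))
    (h : ∀ (S : Set C) (a : A) (b : B), f (sSup S) a b = ⨆ c ∈ S, f c a b) :
    IsBilinear fun (U : tens A B) (c : C) => tensorDesc (f c) (hf c) U where
  sSup_left S c := by rw [map_sSup, sSup_image]
  sSup_right U S := by
    change (⨆ p ∈ U.1, f (sSup S) p.1 p.2) = ⨆ c ∈ S, ⨆ p ∈ U.1, f c p.1 p.2
    refine eq_of_forall_ge_iff fun d => ?_
    simp only [h, iSup_le_iff]
    exact ⟨fun H c hc p hp => H p hp c hc, fun H p hp c hc => H c hc p hp⟩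

theorem tmul_sSup_left {A B : SupLat.{u}} (S : Set A) (b : B) :
    (sSup S) ⊗ₛ b = ⨆ a ∈ S, a ⊗ₛ b := isBilinear_tmul.sSup_left S b

theorem tmul_sSup_right {A B : SupLat.{u}} (a : A) (S : Set B) :
    a ⊗ₛ (sSup S) = ⨆ b ∈ S, a ⊗ₛ b := isBilinear_tmul.sSup_right a S

theorem tmul_iSup_left {A B : SupLat.{u}} {ι : Sort*} (s : ι → A) (b : B) :
    (⨆ i, s i) ⊗ₛ b = ⨆ i, s i ⊗ₛ b := by
  rw [iSup, tmul_sSup_left, iSup_range]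

theorem tmul_iSup_right {A B : SupLat.{u}} {ι : Sort*} (a : A) (s : ι → B) :
    a ⊗ₛ (⨆ i, s i) = ⨆ i, a ⊗ₛ s i := by
  rw [iSup, tmul_sSup_right, iSup_range]

theorem isBilinear_tmul_tmul {A B C : SupLat.{u}} (c : C) :
    IsBilinear (fun (a : A) (b : B) => a ⊗ₛ (b ⊗ₛ c)) :=
  ⟨fun S _ => tmul_sSup_left S _, fun a S => by
    rw [tmul_sSup_left]; simp only [tmul_iSup_right]⟩

/-- The associativity map `(A ⊗ B) ⊗ C ⟶ A ⊗ (B ⊗ C)`. -/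
def assocHom (A B C : SupLat.{u}) : tens (tens A B) C ⟶ tens A (tens B C) :=
  tensorDesc (fun U c => tensorDesc (fun (a : A) (b : B) => a ⊗ₛ (b ⊗ₛ c))
      (isBilinear_tmul_tmul c) U)
    (isBilinear_lift (fun (c : C) (a : A) (b : B) => a ⊗ₛ (b ⊗ₛ c)) isBilinear_tmul_tmul
      fun S a b => by rw [tmul_sSup_right]; simp only [tmul_iSup_right])

@[simp] theorem assocHom_tmul {A B C : SupLat.{u}} (a : A) (b : B) (c : C) :
    assocHom A B C ((a ⊗ₛ b) ⊗ₛ c) = a ⊗ₛ (b ⊗ₛ c) := by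
  rw [assocHom, tensorDesc_tmul, tensorDesc_tmul]

/-- The symmetry `A ⊗ B ⟶ B ⊗ A`. -/
def swapHom (A B : SupLat.{u}) : tens A B ⟶ tens B A :=
  tensorDesc (fun a b => b ⊗ₛ a) isBilinear_tmul.flip

@[simp] theorem swapHom_tmul {A B : SupLat.{u}} (a : A) (b : B) :
    swapHom A B (a ⊗ₛ b) = b ⊗ₛ a := tensorDesc_tmul _ _ _ _

/-- The tensor product of two linear maps. -/
def tensorMap {A B C D : SupLat.{u}} (f : A ⟶ B) (g : C ⟶ D) :
    tens A C ⟶ tens B D :=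
  tensorDesc (fun a c => f a ⊗ₛ g c)
    (isBilinear_tmul.comp (sSupHom.id _) f.hom g.hom)

@[simp] theorem tensorMap_tmul {A B C D : SupLat.{u}} (f : A ⟶ B) (g : C ⟶ D) (a : A) (c : C) :
    tensorMap f g (a ⊗ₛ c) = f a ⊗ₛ g c := tensorDesc_tmul _ _ _ _

/-- The inverse associativity map `A ⊗ (B ⊗ C) ⟶ (A ⊗ B) ⊗ C`. -/
def assocInv (A B C : SupLat.{u}) :
    tens A (tens B C) ⟶ tens (tens A B) C :=
  swapHom A (tens B C) ≫ assocHom B C A ≫ swapHom B (tens C A) ≫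
    assocHom C A B ≫ swapHom C (tens A B)

@[simp] theorem assocInv_tmul {A B C : SupLat.{u}} (a : A) (b : B) (c : C) :
    assocInv A B C (a ⊗ₛ (b ⊗ₛ c)) = (a ⊗ₛ b) ⊗ₛ c := by
  simp only [assocInv, comp_apply]
  rw [swapHom_tmul, assocHom_tmul, swapHom_tmul,
    assocHom_tmul, swapHom_tmul]

theorem tensor_ext_left {A B C D : SupLat.{u}} {f g : tens (tens A B) C ⟶ D}
    (h : ∀ a b c, f ((a ⊗ₛ b) ⊗ₛ c) = g ((a ⊗ₛ b) ⊗ₛ c)) : f = g := by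
  refine tensor_ext fun U c => ?_
  obtain ⟨S, rfl⟩ := eq_iSup_tmul U
  simp only [tmul_iSup_left, map_iSup, h]

theorem tensor_ext_right {A B C D : SupLat.{u}} {f g : tens A (tens B C) ⟶ D}
    (h : ∀ a b c, f (a ⊗ₛ (b ⊗ₛ c)) = g (a ⊗ₛ (b ⊗ₛ c))) : f = g := by
  refine tensor_ext fun a U => ?_
  obtain ⟨S, rfl⟩ := eq_iSup_tmul U
  simp only [tmul_iSup_right, map_iSup, h]

theorem tensor_ext_left₄ {A B C D X : SupLat.{u}}
    {f g : tens (tens (tens A B) C) D ⟶ X}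
    (h : ∀ a b c d, f (((a ⊗ₛ b) ⊗ₛ c) ⊗ₛ d) = g (((a ⊗ₛ b) ⊗ₛ c) ⊗ₛ d)) : f = g := by
  refine tensor_ext_left fun U c d => ?_
  obtain ⟨S, rfl⟩ := eq_iSup_tmul U
  simp only [tmul_iSup_left,
    tmul_iSup_left, map_iSup, h]

/-- The unit `2 = {0 ≤ 1}` of the tensor product, realised as the power set `ℓ 1` of a point. -/
abbrev two : SupLat.{u} := of (Set PUnit.{u + 1})

/-- The truth value in `2` of a proposition. -/
def truth (p : Prop) : two.{u} := {_x | p}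

/-- The isomorphism `2 ⊗ A ⟶ A`. -/
def unitHom (A : SupLat.{u}) : tens two A ⟶ A :=
  tensorDesc (fun p a => ⨆ _ : PUnit.unit ∈ (p : Set PUnit), a)
    ⟨fun S a => eq_of_forall_ge_iff fun b => by simp, fun p S => eq_of_forall_ge_iff fun b => by
      simp only [iSup_le_iff, sSup_le_iff]; tauto⟩

@[simp] theorem unitHom_tmul {A : SupLat.{u}} (p : two) (a : A) :
    unitHom A (p ⊗ₛ a) = ⨆ _ : PUnit.unit ∈ (p : Set PUnit), a :=
  tensorDesc_tmul _ _ _ _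

/-- The inverse isomorphism `A ⟶ 2 ⊗ A`. -/
def unitInv (A : SupLat.{u}) : A ⟶ tens two A :=
  ⟨⟨fun a => (⊤ : two) ⊗ₛ a, fun S => by rw [tmul_sSup_right, sSup_image]⟩⟩

theorem unitInv_apply {A : SupLat.{u}} (a : A) : unitInv A a = (⊤ : two) ⊗ₛ a := rfl

theorem two_cases (p : two.{u}) : p = ⊤ ∨ p = ⊥ := by
  by_cases h : PUnit.unit ∈ (p : Set PUnit)
  · exact Or.inl (Set.eq_univ_of_forall fun x => h)
  · exact Or.inr (Set.eq_empty_of_forall_notMem fun x hx => h hx)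

theorem bot_tmul {A B : SupLat.{u}} (b : B) : (⊥ : A) ⊗ₛ b = ⊥ := by
  rw [← sSup_empty, tmul_sSup_left]; simp

theorem tmul_bot {A B : SupLat.{u}} (a : A) : a ⊗ₛ (⊥ : B) = ⊥ := by
  rw [← sSup_empty, tmul_sSup_right]; simp

theorem unit_hom_inv (A : SupLat.{u}) : unitHom A ≫ unitInv A = 𝟙 _ := by
  refine tensor_ext fun p a => ?_
  rw [comp_apply, unitHom_tmul, unitInv_apply, id_apply]
  rcases two_cases p with rfl | rfl
  · congr 1
    exact iSup_pos (Set.mem_univ PUnit.unit)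
  · rw [bot_tmul]
    have : (⨆ _ : PUnit.unit ∈ ((⊥ : two) : Set PUnit), a) = ⊥ := iSup_neg (Set.notMem_empty _)
    rw [this, tmul_bot]

theorem unit_inv_hom (A : SupLat.{u}) : unitInv A ≫ unitHom A = 𝟙 _ := by
  refine hom_ext fun a => ?_
  rw [comp_apply, unitInv_apply, unitHom_tmul, id_apply]
  exact iSup_pos (Set.mem_univ PUnit.unit)

theorem swap_swap (A B : SupLat.{u}) : swapHom A B ≫ swapHom B A = 𝟙 _ :=
  tensor_ext fun a b => by rw [comp_apply, swapHom_tmul, swapHom_tmul, id_apply]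

section Axioms

variable {A B C D A' B' C' A'' B'' : SupLat.{u}}

theorem tensorMap_id : tensorMap (𝟙 A) (𝟙 B) = 𝟙 (tens A B) :=
  tensor_ext fun a b => by simp

theorem tensorMap_comp (f : A ⟶ A') (g : B ⟶ B') (f' : A' ⟶ A'') (g' : B' ⟶ B'') :
    tensorMap f g ≫ tensorMap f' g' = tensorMap (f ≫ f') (g ≫ g') :=
  tensor_ext fun a b => by simp

theorem assoc_naturality (f : A ⟶ A') (g : B ⟶ B') (h : C ⟶ C') :
    tensorMap (tensorMap f g) h ≫ assocHom A' B' C' =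
      assocHom A B C ≫ tensorMap f (tensorMap g h) :=
  tensor_ext_left fun a b c => by simp

theorem unit_naturality (f : A ⟶ B) :
    tensorMap (𝟙 two) f ≫ unitHom B = unitHom A ≫ f :=
  tensor_ext fun p a => by
    rw [comp_apply, comp_apply, tensorMap_tmul, unitHom_tmul, unitHom_tmul, map_iSup]
    rfl

theorem swap_naturality (f : A ⟶ A') (g : B ⟶ B') :
    tensorMap f g ≫ swapHom A' B' = swapHom A B ≫ tensorMap g f :=
  tensor_ext fun a b => by simp

theorem pentagon_eq : tensorMap (assocHom A B C) (𝟙 D) ≫ assocHom A (tens B C) D ≫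
    tensorMap (𝟙 A) (assocHom B C D) = assocHom (tens A B) C D ≫ assocHom A B (tens C D) :=
  tensor_ext_left₄ fun a b c d => by simp

theorem triangle_eq : assocHom A two B ≫ tensorMap (𝟙 A) (unitHom B) =
    tensorMap (swapHom A two ≫ unitHom A) (𝟙 B) :=
  tensor_ext_left fun a p b => by simp [tmul_iSup_left, tmul_iSup_right]

theorem hexagon_eq : assocHom A B C ≫ swapHom A (tens B C) ≫ assocHom B C A =
    tensorMap (swapHom A B) (𝟙 C) ≫ assocHom B A C ≫ tensorMap (𝟙 B) (swapHom A C) :=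
  tensor_ext_left fun a b c => by simp

theorem hexagon_eq' : assocInv A B C ≫ swapHom (tens A B) C ≫ assocInv C A B =
    tensorMap (𝟙 A) (swapHom B C) ≫ assocInv A C B ≫ tensorMap (swapHom A C) (𝟙 B) :=
  tensor_ext_right fun a b c => by simp

end Axioms

instance : MonoidalCategoryStruct SupLat.{u} where
  tensorObj A B := tens A B
  whiskerLeft A _ _ f := tensorMap (𝟙 A) f
  whiskerRight f B := tensorMap f (𝟙 B)
  tensorHom f g := tensorMap f g
  tensorUnit := two
  associator A B C := ⟨assocHom A B C, assocInv A B C,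
    tensor_ext_left fun a b c => by rw [comp_apply, assocHom_tmul, assocInv_tmul, id_apply],
    tensor_ext_right fun a b c => by rw [comp_apply, assocInv_tmul, assocHom_tmul, id_apply]⟩
  leftUnitor A := ⟨unitHom A, unitInv A, unit_hom_inv A, unit_inv_hom A⟩
  rightUnitor A := ⟨swapHom A two ≫ unitHom A, unitInv A ≫ swapHom two A,
    by rw [Category.assoc, ← Category.assoc (unitHom A), unit_hom_inv, Category.id_comp, swap_swap],
    by rw [Category.assoc, ← Category.assoc (swapHom two A), swap_swap, Category.id_comp,
      unit_inv_hom]⟩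

instance : MonoidalCategory SupLat.{u} := MonoidalCategory.ofTensorHom
  (id_tensorHom_id := fun _ _ => tensorMap_id)
  (id_tensorHom := fun _ _ _ _ => rfl)
  (tensorHom_id := fun _ _ => rfl)
  (tensorHom_comp_tensorHom := tensorMap_comp)
  (associator_naturality := assoc_naturality)
  (leftUnitor_naturality := unit_naturality)
  (rightUnitor_naturality := fun {A B} f => by
    change tensorMap f (𝟙 two) ≫ swapHom B two ≫ unitHom B = (swapHom A two ≫ unitHom A) ≫ f
    rw [← Category.assoc, swap_naturality, Category.assoc, unit_naturality, Category.assoc])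
  (pentagon := fun _ _ _ _ => pentagon_eq)
  (triangle := fun _ _ => triangle_eq)

instance : SymmetricCategory SupLat.{u} where
  braiding A B := ⟨swapHom A B, swapHom B A, swap_swap A B, swap_swap B A⟩
  braiding_naturality_right _ _ _ _ := swap_naturality _ _
  braiding_naturality_left _ _ := swap_naturality _ _
  hexagon_forward _ _ _ := hexagon_eq
  hexagon_reverse _ _ _ := hexagon_eq'
  symmetry A B := swap_swap A B

end SupLat

end SupLattices

/-! ## `ℓ`-relations and cones -/

open scoped MonObj ComonObj HopfObj

/-- The axioms making an `ℓ`-relation `X × Y → G` with values in a locale an `ℓ`-bijection. -/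
structure IsLBijection {X Y G : Type u} [Order.Frame G] (r : X → Y → G) : Prop where
  /-- everywhere defined -/
  ed : ∀ a, ⨆ y, r a y = ⊤
  /-- univalued -/
  uv : ∀ x b₁ b₂, b₁ ≠ b₂ → r x b₁ ⊓ r x b₂ = ⊥
  /-- surjective -/
  su : ∀ b, ⨆ x, r x b = ⊤
  /-- injective -/
  inj : ∀ a₁ a₂ y, a₁ ≠ a₂ → r a₁ y ⊓ r a₂ y = ⊥

section Cones

variable {E : Type w} [Category.{u} E] [IsGrothendieckTopos E] (F : E ⥤ Type u)

/-- A `◇`-cone with values in a sup-lattice `H`: a family of `ℓ`-relations `TX × TX → H`, where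
`T = Rel(F)`, such that for every arrow `R : X ⟶ Y` of `Rel(E)` the two composites
`TX × TY → H` through `TX × (TR)ᵒᵖ` and through `TR × TY` are equal. These are the cowedges of
which the coend `End^∨(T) = ∫^X TX ⊗ (TX)^∧` in sup-lattices is the universal one. -/
structure LozengeCone [PreservesFiniteLimits F] [F.PreservesEpimorphisms]
    (H : Type u) [CompleteLattice H] where
  /-- The `ℓ`-relations of the cone. -/
  rel : ∀ X : E, F.obj X → F.obj X → H
  lozenge : ∀ {X Y : E} (R : RelOf.of X ⟶ RelOf.of Y) (a : F.obj X) (b : F.obj Y),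
    ⨆ (y : F.obj X) (_ : (y, b) ∈ ((relFunctor F).map R).rel), rel X a y =
      ⨆ (x : F.obj Y) (_ : (a, x) ∈ ((relFunctor F).map R).rel), rel Y x b

/-- A `▷`-cone of `ℓ`-bijections with values in a locale `G`. -/
structure TriangleCone (G : Type u) [Order.Frame G] where
  /-- The `ℓ`-relations of the cone. -/
  rel : ∀ X : E, F.obj X → F.obj X → G
  triangle : ∀ {X Y : E} (f : X ⟶ Y) (a b : F.obj X),
    rel X a b ≤ rel Y (F.map f a) (F.map f b)
  bijection : ∀ X : E, IsLBijection (rel X)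

variable {F}

/-- The universal `◇`-cone in the category of sup-lattices; its vertex is the (large) coend
`End^∨(Rel(F))`. -/
def LozengeCone.IsUniversal [PreservesFiniteLimits F] [F.PreservesEpimorphisms] {H : SupLat.{u}}
    (l : LozengeCone F H) : Prop :=
  ∀ (K : SupLat.{u}) (κ : LozengeCone F K),
    ∃! φ : H ⟶ K, ∀ (X : E) (a b : F.obj X), φ (l.rel X a b) = κ.rel X a b

/-- The universal `▷`-cone of `ℓ`-bijections in the category of locales; its vertex is the locale
`Aut(F)`. -/
def TriangleCone.IsUniversal {G : Type u} [Order.Frame G] (m : TriangleCone F G) : Prop :=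
  ∀ (K : Type u) [Order.Frame K] (κ : TriangleCone F K),
    ∃! φ : FrameHom G K, ∀ (X : E) (a b : F.obj X), φ (m.rel X a b) = κ.rel X a b

/-- A localic group, seen as a Hopf algebra in `sℓ` which is a locale: the underlying sup-lattice is
a locale, and the multiplication and the unit of the algebra are the infimum and the top element.
As `⊗` is the coproduct of locales, the comultiplication, counit and antipode are then the
multiplication, unit and inverse of a group object in the opposite of the category of locales. -/
structure IsLocalicGroup (H : SupLat.{u}) (h : HopfObj H) : Prop where
  inf_sSup : ∀ (a : H) (S : Set H), a ⊓ sSup S = ⨆ b ∈ S, a ⊓ b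
  mul : ∀ a b : H, μ[H] (a ⊗ₛ b) = a ⊓ b
  one : η[H] (⊤ : SupLat.two) = (⊤ : H)

/-- The comultiplication, counit and antipode are given on the elements of a cone by
`[X, a, b] ↦ ⋁ₓ [X, a, x] ⊗ [X, x, b]`, `[X, a, b] ↦ δ_{a = b}` and `[X, a, b] ↦ [X, b, a]`. -/
structure HasConeCogroup {H : SupLat.{u}} (r : ∀ X : E, F.obj X → F.obj X → H) (h : HopfObj H) :
    Prop where
  comul : ∀ (X : E) (a b : F.obj X), Δ[H] (r X a b) = ⨆ x : F.obj X, r X a x ⊗ₛ r X x b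
  counit : ∀ (X : E) (a b : F.obj X), ε[H] (r X a b) = SupLat.truth (a = b)
  antipode : ∀ (X : E) (a b : F.obj X), 𝒮[H] (r X a b) = r X b a

/-- The Hopf algebra structure of Tannaka theory on the coend `End^∨(Rel(F))`. A pair of elements of
`F (X × Y) = F X × F Y` is given through its projections. -/
structure LozengeCone.IsTannakaHopf [PreservesFiniteLimits F] [F.PreservesEpimorphisms]
    {H : SupLat.{u}} (l : LozengeCone F H) (h : HopfObj H) : Prop
    extends HasConeCogroup l.rel h where
  mul : ∀ (X Y : E) (z z' : F.obj (X ⨯ Y)),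
    μ[H] (l.rel X (F.map prod.fst z) (F.map prod.fst z') ⊗ₛ
      l.rel Y (F.map prod.snd z) (F.map prod.snd z')) = l.rel (X ⨯ Y) z z'
  one : ∀ s s' : F.obj (⊤_ E), η[H] (⊤ : SupLat.two) = l.rel (⊤_ E) s s'

/-- The localic group structure on the locale `Aut(F)`. -/
structure TriangleCone.IsAutGroup {G : Type u} [Order.Frame G] (m : TriangleCone F G)
    (h : HopfObj (SupLat.of G)) : Prop extends
    HasConeCogroup (H := SupLat.of G) m.rel h, IsLocalicGroup (SupLat.of G) h

end Cones

/-! Write `[X,a,b]` for the elements of a cone. Every relation R ↣ X × Y is the opposite of the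
graph of its first leg followed by the graph of its second. A ◇-cone is therefore the same thing as
a family compatible with graphs and opposite graphs of arrows of E (`IsMapCone`): `[Y,f(a),b]` is
the supremum of the `[X,a,y]` with f(y) = b, and symmetrically. A ▷-cone of ℓ-bijections satisfies
these equations too (`TriangleCone.isMapCone`), so both universal problems concern families of the
same kind.

The universal ◇-cone is built from generators and relations, as a lattice of ideals. This lattice is
small because E has a small separating family and F, being a left adjoint, makes every element of FX
come from a member of it.

The central point is that its vertex H is a locale. For fixed b, b' in FY, the family `[X ×
Y,(a,b),(a',b')]` is again a cone in X, so it induces a linear endomap of H. Projections and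
diagonals show that this map is x ↦ x ∧ `[Y,b,b']` (`desc_prod_right`). Meets with generators thus
preserve suprema, and as the generators are sup-dense, H is a frame in which `[X,a,a']` ∧ `[Y,b,b']`
is the generator of the product. The diagonal of X then gives univaluedness and injectivity, and the
map X → 1 gives totality and surjectivity: the cone consists of ℓ-bijections.

Conversely, meets in any ▷-cone of ℓ-bijections obey the same product formula, so the linear map
induced on H is a frame homomorphism (`desc_inf`). Hence H also carries the universal ▷-cone, and
any vertex G of such a cone is isomorphic to H and is itself universal among ◇-cones. A single
construction of the Hopf structure, with each axiom checked on generators, then serves both sides.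
-/

noncomputable section

variable {E : Type w} [Category.{u} E] {F : E ⥤ Type u}

/-! ## Cones with respect to maps -/

/-- The condition on a family of `ℓ`-relations of being a `◇`-cone with respect to the graphs of the
arrows of `E` and their opposites. -/
structure IsMapCone {H : Type*} [CompleteLattice H] (r : ∀ X : E, F.obj X → F.obj X → H) :
    Prop where
  map_left : ∀ {X Y : E} (f : X ⟶ Y) (a : F.obj X) (b : F.obj Y),
    r Y (F.map f a) b = ⨆ (y : F.obj X) (_ : F.map f y = b), r X a y
  map_right : ∀ {X Y : E} (f : X ⟶ Y) (a : F.obj Y) (b : F.obj X),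
    r Y a (F.map f b) = ⨆ (x : F.obj X) (_ : F.map f x = a), r X x b

namespace IsMapCone

section
variable {H : Type*} [CompleteLattice H] {r : ∀ X : E, F.obj X → F.obj X → H}

theorem le_map (hr : IsMapCone r) {X Y : E} (f : X ⟶ Y) (a b : F.obj X) :
    r X a b ≤ r Y (F.map f a) (F.map f b) := by
  rw [hr.map_left]
  exact le_iSup₂_of_le b rfl le_rfl

theorem comp (hr : IsMapCone r) {K : Type*} [CompleteLattice K] (φ : sSupHom H K) :
    IsMapCone fun X a b => φ (r X a b) :=
  ⟨fun f a b => by rw [hr.map_left]; simp only [map_iSup],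
    fun f a b => by rw [hr.map_right]; simp only [map_iSup]⟩

theorem swap (hr : IsMapCone r) : IsMapCone fun X a b => r X b a :=
  ⟨fun f a b => hr.map_right f b a, fun f a b => hr.map_left f b a⟩

end

end IsMapCone

/-! ### Relations as spans: ◇-cones are the cones with respect to maps. -/

section Relations

/-- The graph of an arrow, as a relation. -/
def RelOf.graph [HasFiniteLimits E] {X Y : E} (f : X ⟶ Y) : RelOf.Hom (RelOf.of X) (RelOf.of Y) :=
  ⟨Subobject.mk (prod.lift (𝟙 X) f)⟩

/-- The opposite of the graph of an arrow, as a relation. -/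
def RelOf.opGraph [HasFiniteLimits E] {X Y : E} (f : X ⟶ Y) : RelOf.Hom (RelOf.of Y) (RelOf.of X) :=
  ⟨Subobject.mk (prod.lift f (𝟙 X))⟩

theorem mem_relMap_mk [HasFiniteLimits E] {X Y Z : E} (p : Z ⟶ X) (q : Z ⟶ Y)
    [Mono (prod.lift p q)] (a : F.obj X) (b : F.obj Y) :
    (a, b) ∈ relMap F (X := RelOf.of X) (Y := RelOf.of Y) ⟨Subobject.mk (prod.lift p q)⟩ ↔
      ∃ z : F.obj Z, F.map p z = a ∧ F.map q z = b := by
  let i := Subobject.underlyingIso (prod.lift p q)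
  let R : RelOf.Hom (RelOf.of X) (RelOf.of Y) := ⟨Subobject.mk (prod.lift p q)⟩
  have h1 : i.hom ≫ p = R.fst := by
    change _ = _ ≫ _
    rw [← Subobject.underlyingIso_hom_comp_eq_mk, Category.assoc, prod.lift_fst]
  have h2 : i.hom ≫ q = R.snd := by
    change _ = _ ≫ _
    rw [← Subobject.underlyingIso_hom_comp_eq_mk, Category.assoc, prod.lift_snd]
  have h3 : i.inv ≫ R.fst = p := by rw [← h1, Iso.inv_hom_id_assoc]
  have h4 : i.inv ≫ R.snd = q := by rw [← h2, Iso.inv_hom_id_assoc]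
  constructor
  · rintro ⟨r, h, h'⟩
    refine ⟨F.map i.hom r, ?_, ?_⟩
    · rw [← Functor.map_comp_apply, h1]; exact h
    · rw [← Functor.map_comp_apply, h2]; exact h'
  · rintro ⟨z, rfl, rfl⟩
    refine ⟨F.map i.inv z, ?_, ?_⟩
    · change F.map R.fst _ = _
      rw [← Functor.map_comp_apply, h3]
    · change F.map R.snd _ = _
      rw [← Functor.map_comp_apply, h4]

theorem mem_relMap_graph [HasFiniteLimits E] {X Y : E} (f : X ⟶ Y) (a : F.obj X) (b : F.obj Y) :
    (a, b) ∈ relMap F (RelOf.graph f) ↔ F.map f a = b := by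
  refine (mem_relMap_mk _ _ a b).trans ⟨?_, ?_⟩
  · rintro ⟨z, rfl, h⟩
    simpa using h
  · rintro rfl
    exact ⟨a, by simp, rfl⟩

theorem mem_relMap_opGraph [HasFiniteLimits E] {X Y : E} (f : X ⟶ Y) (a : F.obj X) (b : F.obj Y) :
    (b, a) ∈ relMap F (RelOf.opGraph f) ↔ F.map f a = b := by
  refine (mem_relMap_mk _ _ b a).trans ⟨?_, ?_⟩
  · rintro ⟨z, h, rfl⟩
    simpa using h
  · rintro rfl
    exact ⟨a, rfl, by simp⟩

variable (F) in
-- Both sides are compared through the object R. For t in FR, expanding along the first leg turns r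
-- X a (fst t) into a supremum of r R s t over the s lying above a; pushing each term along the
-- second leg lands in the right-hand side. The other inequality exchanges the legs.
theorem IsMapCone.lozenge_relMap [HasFiniteLimits E] {H : Type*} [CompleteLattice H]
    {r : ∀ X : E, F.obj X → F.obj X → H} (hr : IsMapCone r) {X Y : E}
    (R : RelOf.Hom (RelOf.of X) (RelOf.of Y)) (a : F.obj X) (b : F.obj Y) :
    ⨆ (y : F.obj X) (_ : (y, b) ∈ relMap F R), r X a y =
      ⨆ (x : F.obj Y) (_ : (a, x) ∈ relMap F R), r Y x b := by
  refine le_antisymm (iSup₂_le ?_) (iSup₂_le ?_)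
  · rintro _ ⟨t, rfl, rfl⟩
    change r X a (F.map R.fst t) ≤ _
    rw [hr.map_right]
    refine iSup₂_le ?_
    rintro s rfl
    exact le_iSup₂_of_le (F.map R.snd s) ⟨s, rfl, rfl⟩ (hr.le_map R.snd s t)
  · rintro _ ⟨s, rfl, rfl⟩
    change r Y (F.map R.snd s) b ≤ _
    rw [hr.map_left]
    refine iSup₂_le ?_
    rintro t rfl
    exact le_iSup₂_of_le (F.map R.fst t) ⟨t, rfl, rfl⟩ (hr.le_map R.fst s t)

end Relations

section

variable [IsGrothendieckTopos E] [PreservesFiniteLimits F] [F.PreservesEpimorphisms]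

/-- For the graph of f one of the two suprema in the ◇-equation runs over the single element f(a),
leaving the equation for f. The opposite graph gives the symmetric one. -/
theorem LozengeCone.isMapCone {H : Type u} [CompleteLattice H] (l : LozengeCone F H) :
    IsMapCone l.rel where
  map_left {X Y} f a b := by
    have h := l.lozenge (RelOf.graph f) a b
    have e : ∀ (x : F.obj X) (y : F.obj Y),
        (x, y) ∈ ((relFunctor F).map (X := RelOf.of X) (Y := RelOf.of Y) (RelOf.graph f)).rel ↔
          F.map f x = y := mem_relMap_graph f
    simp only [e, iSup_iSup_eq_right] at h
    exact h.symm
  map_right {X Y} f a b := by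
    have h := l.lozenge (RelOf.opGraph f) a b
    have e : ∀ (x : F.obj X) (y : F.obj Y),
        (y, x) ∈ ((relFunctor F).map (X := RelOf.of Y) (Y := RelOf.of X) (RelOf.opGraph f)).rel ↔
          F.map f x = y := mem_relMap_opGraph f
    simp only [e, iSup_iSup_eq_right] at h
    exact h

/-- The `◇`-cone given by a cone with respect to maps. -/
@[simps]
def IsMapCone.lozengeCone {H : Type u} [CompleteLattice H]
    {r : ∀ X : E, F.obj X → F.obj X → H} (hr : IsMapCone r) : LozengeCone F H where
  rel := r
  lozenge R a b := hr.lozenge_relMap F R a b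

end

/-- Totality writes ⊤ as the supremum of the `[X,a,y]`, and distributivity of G splits `[Y,f(a),b]`
along it. A term with f(y) ≠ b lies below `[Y,f(a),b]` ∧ `[Y,f(a),f(y)]`, which is 0 by
univaluedness. Surjectivity and injectivity do the same in the other variable. -/
theorem TriangleCone.isMapCone [IsGrothendieckTopos E] {G : Type u} [Order.Frame G]
    (m : TriangleCone F G) : IsMapCone m.rel where
  map_left {X Y} f a b := by
    refine le_antisymm ?_ (iSup₂_le fun y h => h ▸ m.triangle f a y)
    rw [← inf_top_eq (m.rel Y _ b), ← (m.bijection X).ed a, inf_iSup_eq]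
    refine iSup_le fun y => ?_
    by_cases h : F.map f y = b
    · exact inf_le_right.trans (le_iSup₂_of_le y h le_rfl)
    · refine (inf_le_inf_left _ (m.triangle f a y)).trans ?_
      rw [(m.bijection Y).uv _ _ _ (Ne.symm h)]
      exact bot_le
  map_right {X Y} f a b := by
    refine le_antisymm ?_ (iSup₂_le fun y h => h ▸ m.triangle f y b)
    rw [← inf_top_eq (m.rel Y a _), ← (m.bijection X).su b, inf_iSup_eq]
    refine iSup_le fun x => ?_
    by_cases h : F.map f x = a
    · exact inf_le_right.trans (le_iSup₂_of_le x h le_rfl)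
    · refine (inf_le_inf_left _ (m.triangle f x b)).trans ?_
      rw [(m.bijection Y).inj _ _ _ (Ne.symm h)]
      exact bot_le

/-! ## Products -/

section Products

variable [HasFiniteLimits E] [PreservesFiniteLimits F]

theorem isPullback_map_prod (X Y : E) : IsPullback (F.map (prod.fst : X ⨯ Y ⟶ X))
    (F.map (prod.snd : X ⨯ Y ⟶ Y)) (F.map (terminal.from X)) (F.map (terminal.from Y)) :=
  (IsPullback.of_hasBinaryProduct' X Y).map F

/-- Lets `default` stand for the point * of F1 in later computations. -/
instance uniqueMapTerminal : Unique (F.obj (⊤_ E)) :=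
  Types.isTerminalEquivUnique _ (IsTerminal.isTerminalObj F _ terminalIsTerminal)

theorem exists_pair {X Y : E} (a : F.obj X) (b : F.obj Y) :
    ∃ z : F.obj (X ⨯ Y), F.map prod.fst z = a ∧ F.map prod.snd z = b :=
  Types.exists_of_isPullback (isPullback_map_prod X Y) a b (Subsingleton.elim _ _)

/-- The element of `F (X × Y)` given by a pair of elements of `F X` and `F Y`. -/
def pair {X Y : E} (a : F.obj X) (b : F.obj Y) : F.obj (X ⨯ Y) := (exists_pair a b).choose

@[simp] theorem map_fst_pair {X Y : E} (a : F.obj X) (b : F.obj Y) :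
    F.map prod.fst (pair a b) = a := (exists_pair a b).choose_spec.1

@[simp] theorem map_snd_pair {X Y : E} (a : F.obj X) (b : F.obj Y) :
    F.map prod.snd (pair a b) = b := (exists_pair a b).choose_spec.2

theorem pair_ext {X Y : E} {z z' : F.obj (X ⨯ Y)} (h : F.map prod.fst z = F.map prod.fst z')
    (h' : F.map prod.snd z = F.map prod.snd z') : z = z' :=
  Types.ext_of_isPullback (isPullback_map_prod X Y) h h'

@[simp] theorem pair_eta {X Y : E} (z : F.obj (X ⨯ Y)) :
    pair (F.map prod.fst z) (F.map prod.snd z) = z := pair_ext (by simp) (by simp)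

theorem map_lift_apply {X Y Z : E} (f : Z ⟶ X) (g : Z ⟶ Y) (z : F.obj Z) :
    F.map (prod.lift f g) z = pair (F.map f z) (F.map g z) := by
  refine pair_ext ?_ ?_
  · rw [map_fst_pair, ← Functor.map_comp_apply, prod.lift_fst]
  · rw [map_snd_pair, ← Functor.map_comp_apply, prod.lift_snd]

theorem pair_eq_iff {X Y : E} {a : F.obj X} {b : F.obj Y} {z : F.obj (X ⨯ Y)} :
    pair a b = z ↔ a = F.map prod.fst z ∧ b = F.map prod.snd z := by
  constructor
  · rintro rfl; simp
  · rintro ⟨rfl, rfl⟩; simp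

/-- `F (X × Y)` is the product of `F X` and `F Y`. -/
def pairEquiv (X Y : E) : F.obj X × F.obj Y ≃ F.obj (X ⨯ Y) where
  toFun p := pair p.1 p.2
  invFun z := (F.map prod.fst z, F.map prod.snd z)
  left_inv p := by simp
  right_inv z := by simp

theorem map_map_id_pair {X X' : E} (f : X ⟶ X') (Y : E) (a : F.obj X) (b : F.obj Y) :
    F.map (prod.map f (𝟙 Y)) (pair a b) = pair (F.map f a) b := by
  refine pair_ext ?_ ?_ <;> rw [← Functor.map_comp_apply] <;> simp

end Products

/-! ## Existence of the universal cone -/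

/-- The sheaves freely generated by one section over an object of the site separate, since a point
separates sets; the equivalence carries them to E. What matters is that the index type lies in `Type
u`. -/
theorem IsGrothendieckTopos.exists_isSeparating (E : Type w) [Category.{u} E]
    [IsGrothendieckTopos E] : ∃ (I : Type u) (c : I → E),
      ObjectProperty.IsSeparating (.ofObj c) := by
  obtain ⟨C, _, J, ⟨e⟩⟩ := exists_site (E := E)
  have h0 : ObjectProperty.IsSeparating (.ofObj fun _ : PUnit.{u + 1} => (PUnit : Type u)) := by
    intro X Y f g h
    exact Types.isSeparator_punit f g fun G hG => h G (by
      obtain rfl : G = PUnit := by simpa [eq_comm] using hG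
      exact ObjectProperty.ofObj_apply (fun _ : PUnit.{u + 1} => (PUnit : Type u)) ⟨⟩)
  have h1 := Sheaf.isSeparating (J := J) h0
  refine ⟨C × PUnit.{u + 1},
    fun i => e.inverse.obj (Sheaf.freeYoneda J i.1 (PUnit.{u + 1} : Type u)), fun X Y f g h => ?_⟩
  refine e.functor.map_injective (h1 _ _ fun G hG k => ?_)
  obtain ⟨i⟩ := hG
  let adj : e.inverse ⊣ e.functor := e.symm.toAdjunction
  obtain ⟨k, rfl⟩ :=
    (adj.homEquiv (Sheaf.freeYoneda J i.1 (PUnit.{u + 1} : Type u)) X).surjective k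
  have := h _ (ObjectProperty.ofObj_apply _ i) k
  exact (adj.homEquiv_naturality_right k f).symm.trans
    ((congrArg _ this).trans (adj.homEquiv_naturality_right k g))

/-- The predicates "reached from some c i" and "true" on FX correspond under the adjunction to two
arrows out of X. These agree after every arrow c i → X, hence are equal, so every element is
reached. -/
theorem exists_map_eq_of_isSeparating [F.IsLeftAdjoint] {I : Type*} {c : I → E}
    (hc : ObjectProperty.IsSeparating (.ofObj c)) {X : E} (a : F.obj X) :
    ∃ (i : I) (f : c i ⟶ X) (x : F.obj (c i)), F.map f x = a := by
  let adj := Adjunction.ofIsLeftAdjoint F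
  let p : F.obj X ⟶ ULift.{u} Prop := ↾fun x => ⟨∃ (i : I) (f : c i ⟶ X) (y : F.obj (c i)),
    F.map f y = x⟩
  let q : F.obj X ⟶ ULift.{u} Prop := ↾fun _ => ⟨True⟩
  have h : p = q := by
    refine (adj.homEquiv _ _).injective (hc _ _ ?_)
    rintro _ ⟨i⟩ f
    rw [← Adjunction.homEquiv_naturality_left, ← Adjunction.homEquiv_naturality_left]
    congr 1
    ext x
    exact ⟨fun _ => trivial, fun _ => ⟨i, f, x, rfl⟩⟩
  have h' : p a = q a := by rw [h]
  exact of_eq_true (congrArg ULift.down h')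

variable (F) in
/-- An ideal is a family of relations which is the set of the elements which a cone sends below a
fixed element. -/
structure ConeIdeal where
  /-- The relations of the family. -/
  mem : ∀ X : E, F.obj X → F.obj X → Prop
  map_left : ∀ {X Y : E} (f : X ⟶ Y) (a : F.obj X) (b : F.obj Y),
    mem Y (F.map f a) b ↔ ∀ y, F.map f y = b → mem X a y
  map_right : ∀ {X Y : E} (f : X ⟶ Y) (a : F.obj Y) (b : F.obj X),
    mem Y a (F.map f b) ↔ ∀ x, F.map f x = a → mem X x b

namespace ConeIdeal

theorem mem_injective : Function.Injective (mem : ConeIdeal F → _) := by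
  rintro ⟨m, _, _⟩ ⟨m', _, _⟩ h
  cases h
  rfl

instance : PartialOrder (ConeIdeal F) := PartialOrder.lift mem mem_injective

instance : InfSet (ConeIdeal F) where
  sInf S := ⟨fun X a b => ∀ U ∈ S, U.mem X a b,
    fun f a b => ⟨fun h y hy U hU => (U.map_left f a b).1 (h U hU) y hy,
      fun h U hU => (U.map_left f a b).2 fun y hy => h y hy U hU⟩,
    fun f a b => ⟨fun h y hy U hU => (U.map_right f a b).1 (h U hU) y hy,
      fun h U hU => (U.map_right f a b).2 fun y hy => h y hy U hU⟩⟩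

instance : CompleteLattice (ConeIdeal F) :=
  completeLatticeOfInf _ fun _ =>
    ⟨fun U hU _ _ _ hp => hp U hU, fun _ hV _ _ _ hp _ hU => hV hU _ _ _ hp⟩

variable (F) in
/-- The ideal generated by a pair of elements. -/
def gen (X : E) (a b : F.obj X) : ConeIdeal F := sInf {U | U.mem X a b}

theorem gen_le_iff {X : E} {a b : F.obj X} {U : ConeIdeal F} : gen F X a b ≤ U ↔ U.mem X a b :=
  ⟨fun h => h _ _ _ (fun _ hV => hV), fun h => sInf_le h⟩

theorem isMapCone_gen : IsMapCone (gen F) where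
  map_left f a b := eq_of_forall_ge_iff fun U => by
    simp only [gen_le_iff, iSup_le_iff, U.map_left]
  map_right f a b := eq_of_forall_ge_iff fun U => by
    simp only [gen_le_iff, iSup_le_iff, U.map_right]

theorem eq_iSup_gen (U : ConeIdeal F) :
    U = ⨆ (X : E) (a : F.obj X) (b : F.obj X) (_ : U.mem X a b), gen F X a b := by
  refine le_antisymm (fun X a b h => gen_le_iff.1 ?_)
    (iSup_le fun _ => iSup_le fun _ => iSup_le fun _ => iSup_le fun h => gen_le_iff.2 h)
  exact le_iSup_of_le X (le_iSup_of_le a (le_iSup₂_of_le b h le_rfl))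

section

variable {K : Type*} [CompleteLattice K] {r : ∀ X : E, F.obj X → F.obj X → K}

/-- The cone equations for r say exactly that the pairs sent below c form an ideal. The extension of
r to ideals is thus a left adjoint, so it preserves suprema. -/
theorem galoisConnection (hr : IsMapCone r) : GaloisConnection
    (fun U : ConeIdeal F => ⨆ (X : E) (a : F.obj X) (b : F.obj X) (_ : U.mem X a b), r X a b)
    (fun c => ⟨fun X a b => r X a b ≤ c, fun f a b => by simp [hr.map_left],
      fun f a b => by simp [hr.map_right]⟩) := fun U c => by
  simp only [iSup_le_iff]; rfl

/-- The linear map induced by a cone. -/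
def lift (hr : IsMapCone r) : sSupHom (ConeIdeal F) K where
  toFun U := ⨆ (X : E) (a : F.obj X) (b : F.obj X) (_ : U.mem X a b), r X a b
  map_sSup' S := by rw [(galoisConnection hr).l_sSup, sSup_image]

theorem lift_gen (hr : IsMapCone r) (X : E) (a b : F.obj X) : lift hr (gen F X a b) = r X a b :=
  eq_of_forall_ge_iff fun c => ((galoisConnection hr) _ c).trans gen_le_iff

theorem hom_ext {φ ψ : sSupHom (ConeIdeal F) K}
    (h : ∀ X a b, φ (gen F X a b) = ψ (gen F X a b)) : φ = ψ := by
  ext U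
  rw [eq_iSup_gen U]
  simp only [map_iSup, h]

end

/-- An ideal is determined by its restriction to the separating objects: if a = f(x) with x in F(c
i), then `map_left` expresses membership of (a, b) through pairs (x, y) over c i. -/
theorem small [IsGrothendieckTopos E] [F.IsLeftAdjoint] : Small.{u} (ConeIdeal F) := by
  obtain ⟨I, c, hc⟩ := IsGrothendieckTopos.exists_isSeparating E
  refine small_of_injective
    (f := fun (U : ConeIdeal F) (i : I) (a b : F.obj (c i)) => U.mem (c i) a b) ?_
  intro U V h
  refine mem_injective (funext fun X => funext fun a => funext fun b => ?_)
  obtain ⟨i, f, x, rfl⟩ := exists_map_eq_of_isSeparating hc a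
  have h' : ∀ y, U.mem (c i) x y = V.mem (c i) x y := fun y =>
    congrFun (congrFun (congrFun h i) x) y
  rw [U.map_left, V.map_left]
  simp only [h']

end ConeIdeal

/-- The complete lattice structure on a small copy of a complete lattice. -/
instance Shrink.instCompleteLattice (α : Type*) [Small.{u} α] [CompleteLattice α] :
    CompleteLattice (Shrink.{u} α) :=
  letI : InfSet (Shrink.{u} α) := ⟨fun S => equivShrink α (sInf (equivShrink α ⁻¹' S))⟩
  completeLatticeOfInf _ fun S => by
    refine ⟨fun x hx => ?_, fun x hx => ?_⟩
    · rw [← (orderIsoShrink α).apply_symm_apply x]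
      exact (orderIsoShrink α).monotone (sInf_le (by simpa using hx))
    · rw [← (orderIsoShrink α).apply_symm_apply x]
      refine (orderIsoShrink α).monotone (le_sInf fun y hy => ?_)
      exact (OrderIso.symm_apply_le _).2 (hx hy)

theorem exists_lozengeCone_isUniversal [IsGrothendieckTopos E] (F : E ⥤ Type u)
    [PreservesFiniteLimits F] [F.IsLeftAdjoint] :
    ∃ (H : SupLat.{u}) (l : LozengeCone F H), l.IsUniversal := by
  have := ConeIdeal.small (F := F)
  let e := orderIsoShrink.{u} (ConeIdeal F)
  let s : sSupHom (ConeIdeal F) (Shrink.{u} (ConeIdeal F)) :=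
    ⟨e, fun S => by rw [e.map_sSup, sSup_image]⟩
  let t : sSupHom (Shrink.{u} (ConeIdeal F)) (ConeIdeal F) :=
    ⟨e.symm, fun S => by rw [e.symm.map_sSup, sSup_image]⟩
  refine ⟨SupLat.of (Shrink.{u} (ConeIdeal F)),
    (ConeIdeal.isMapCone_gen.comp s).lozengeCone, fun K κ => ?_⟩
  refine ⟨⟨(ConeIdeal.lift κ.isMapCone).comp t⟩, fun X a b => ?_, fun φ hφ => ?_⟩
  · change ConeIdeal.lift κ.isMapCone (e.symm (e (ConeIdeal.gen F X a b))) = _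
    rw [e.symm_apply_apply, ConeIdeal.lift_gen]
  · have : φ.hom.comp s = ConeIdeal.lift κ.isMapCone := ConeIdeal.hom_ext fun X a b =>
      (hφ X a b).trans (ConeIdeal.lift_gen κ.isMapCone X a b).symm
    refine SupLat.hom_ext fun x => ?_
    change φ.hom x = ConeIdeal.lift κ.isMapCone (e.symm x)
    rw [← this]
    exact congrArg φ.hom (e.apply_symm_apply x).symm

/-! ## The locale structure on the vertex of the universal cone -/

theorem SupLat.iSup_tmul_iSup {A B : SupLat.{u}} {I J : Type*} (s : I → A) (t : J → B) :
    (⨆ i, s i) ⊗ₛ (⨆ j, t j) = ⨆ i, ⨆ j, s i ⊗ₛ t j := by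
  rw [SupLat.tmul_iSup_left]
  simp only [SupLat.tmul_iSup_right]

namespace IsMapCone

variable {H : Type*} [CompleteLattice H] {r : ∀ X : E, F.obj X → F.obj X → H}

/-- The fibre of f × 1 over a pair is the fibre of f times a point, so fixing the Y-component leaves
a cone in X. This is what makes multiplication by a generator a linear map. -/
theorem prod_right [HasFiniteLimits E] [PreservesFiniteLimits F] (hr : IsMapCone r) {Y : E}
    (b b' : F.obj Y) :
    IsMapCone fun (X : E) (a a' : F.obj X) => r (X ⨯ Y) (pair a b) (pair a' b') := by
  constructor
  · intro X X' f a a'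
    rw [← map_map_id_pair, hr.map_left, ← (pairEquiv X Y).iSup_comp, iSup_prod]
    refine iSup_congr fun y => ?_
    simp only [pairEquiv, Equiv.coe_fn_mk, map_map_id_pair, pair_eq_iff, map_fst_pair,
      map_snd_pair, iSup_and]
    rw [iSup_comm]
    simp
  · intro X X' f a a'
    rw [← map_map_id_pair, hr.map_right, ← (pairEquiv X Y).iSup_comp, iSup_prod]
    refine iSup_congr fun y => ?_
    simp only [pairEquiv, Equiv.coe_fn_mk, map_map_id_pair, pair_eq_iff, map_fst_pair,
      map_snd_pair, iSup_and]
    rw [iSup_comm]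
    simp

/-- The cone equation for the diagonal X → X × X: the fibre over (b, c) is empty unless b = c. -/
theorem rel_diag [HasFiniteLimits E] [PreservesFiniteLimits F] (hr : IsMapCone r) {X : E}
    (a b c : F.obj X) :
    r (X ⨯ X) (pair a a) (pair b c) = ⨆ _ : b = c, r X a b := by
  have h : pair a a = F.map (prod.lift (𝟙 X) (𝟙 X)) a := by simp [map_lift_apply]
  rw [h, hr.map_left]
  simp only [map_lift_apply, pair_eq_iff, Functor.map_id_apply, map_fst_pair, map_snd_pair,
    iSup_and, iSup_iSup_eq_left]

theorem rel_swap [HasFiniteLimits E] [PreservesFiniteLimits F] (hr : IsMapCone r) {X Y : E}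
    (a a' : F.obj X) (b b' : F.obj Y) :
    r (X ⨯ Y) (pair a b) (pair a' b') ≤ r (Y ⨯ X) (pair b a) (pair b' a') := by
  refine (hr.le_map (prod.lift prod.snd prod.fst) _ _).trans ?_
  simp [map_lift_apply]

theorem rel_le_terminal [HasFiniteLimits E] [PreservesFiniteLimits F] (hr : IsMapCone r) {X : E}
    (a b : F.obj X) (s t : F.obj (⊤_ E)) : r X a b ≤ r (⊤_ E) s t :=
  (hr.le_map (terminal.from X) a b).trans_eq (by congr 1 <;> exact Subsingleton.elim _ _)

/-- The cone equation for X → 1, whose only fibre is all of FX. -/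
theorem iSup_rel_left [HasFiniteLimits E] [PreservesFiniteLimits F] (hr : IsMapCone r) {X : E}
    (a : F.obj X) (s t : F.obj (⊤_ E)) : ⨆ y, r X a y = r (⊤_ E) s t := by
  have h := hr.map_left (terminal.from X) a t
  rw [Subsingleton.elim (F.map (terminal.from X) a) s] at h
  simp [h, eq_iff_true_of_subsingleton]

end IsMapCone

/-! ### Meets of generators, and the frame structure of the coend. -/

namespace LozengeCone.IsUniversal

variable [IsGrothendieckTopos E] [PreservesFiniteLimits F] [F.PreservesEpimorphisms]
  {H K : SupLat.{u}} {l : LozengeCone F H}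

theorem hom_ext (hl : l.IsUniversal) {φ ψ : H ⟶ K}
    (h : ∀ X a b, φ (l.rel X a b) = ψ (l.rel X a b)) : φ = ψ :=
  (hl K (l.isMapCone.comp ψ.hom).lozengeCone).unique h fun _ _ _ => rfl

theorem tensor_ext (hl : l.IsUniversal) {φ ψ : SupLat.tens H H ⟶ K}
    (h : ∀ X a b Y c d, φ (l.rel X a b ⊗ₛ l.rel Y c d) = ψ (l.rel X a b ⊗ₛ l.rel Y c d)) :
    φ = ψ := by
  let curry (θ : SupLat.tens H H ⟶ K) (x : H) : H ⟶ K :=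
    ⟨⟨fun y => θ (x ⊗ₛ y), fun S => by
      rw [SupLat.tmul_sSup_right, sSup_image]; simp only [map_iSup]⟩⟩
  let curry' (θ : SupLat.tens H H ⟶ K) (y : H) : H ⟶ K :=
    ⟨⟨fun x => θ (x ⊗ₛ y), fun S => by
      rw [SupLat.tmul_sSup_left, sSup_image]; simp only [map_iSup]⟩⟩
  refine SupLat.tensor_ext fun x y => ?_
  have h1 : curry' φ y = curry' ψ y := hl.hom_ext fun X a b => by
    have h2 : curry φ (l.rel X a b) = curry ψ (l.rel X a b) := hl.hom_ext fun Y c d => h _ _ _ _ _ _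
    exact congrArg (fun θ : H ⟶ K => θ y) h2
  exact congrArg (fun θ : H ⟶ K => θ x) h1

/-- The linear map out of the universal cone given by another cone. -/
def desc (hl : l.IsUniversal) {r : ∀ X : E, F.obj X → F.obj X → K} (hr : IsMapCone r) : H ⟶ K :=
  (hl K hr.lozengeCone).choose

@[simp] theorem desc_rel (hl : l.IsUniversal) {r : ∀ X : E, F.obj X → F.obj X → K}
    (hr : IsMapCone r) (X : E) (a b : F.obj X) : hl.desc hr (l.rel X a b) = r X a b :=
  (hl K hr.lozengeCone).choose_spec.1 X a b

/-- Sup-density of the generators, extracted from uniqueness alone. For each z, the map c ↦ (c ≰ z)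
into 2 is linear; those for x and x ∧ y agree on generators, hence also at x, which gives x ≤ x ∧ y.
-/
theorem le_of_forall_rel (hl : l.IsUniversal) {x y : H}
    (h : ∀ X a b, l.rel X a b ≤ x → l.rel X a b ≤ y) : x ≤ y := by
  let φ (z : H) : H ⟶ SupLat.two := ⟨⟨fun c => {_p | ¬ c ≤ z}, fun S => by
    refine Set.ext fun p => ?_
    change ¬ (sSup S ≤ z) ↔ p ∈ Set.sUnion _
    simp⟩⟩
  have e : φ x = φ (x ⊓ y) := hl.hom_ext fun X a b => Set.ext fun p => by
    change ¬ _ ↔ ¬ _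
    rw [le_inf_iff, not_iff_not]
    exact ⟨fun hx => ⟨hx, h X a b hx⟩, And.left⟩
  have e' : φ x x = φ (x ⊓ y) x := by rw [e]
  have : ¬ (x ≤ x) ↔ ¬ (x ≤ x ⊓ y) := Set.ext_iff.1 e' PUnit.unit
  rw [not_iff_not] at this
  exact (this.1 le_rfl).trans inf_le_right

theorem eq_iSup_rel (hl : l.IsUniversal) (x : H) :
    x = ⨆ (X : E) (a : F.obj X) (b : F.obj X) (_ : l.rel X a b ≤ x), l.rel X a b :=
  le_antisymm (hl.le_of_forall_rel fun X a b h =>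
      le_iSup_of_le X (le_iSup_of_le a (le_iSup₂_of_le b h le_rfl)))
    (iSup_le fun _ => iSup_le fun _ => iSup_le fun _ => iSup_le id)

theorem rel_prod_le (l : LozengeCone F H) {X Y : E} (z z' : F.obj (X ⨯ Y)) :
    l.rel (X ⨯ Y) z z' ≤ l.rel X (F.map prod.fst z) (F.map prod.fst z') ⊓
      l.rel Y (F.map prod.snd z) (F.map prod.snd z') :=
  le_inf (l.isMapCone.le_map _ _ _) (l.isMapCone.le_map _ _ _)

/-- The projections give ≤. For ≥, take a generator g = `[Z,c,c']` below both x and `[Y,b,b']`. The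
diagonal of Z makes g a fixed point of its own product map; monotonicity replaces the first factor
by `[Y,b,b']`, the symmetry of the product exchanges the factors, and monotonicity again replaces g
by x. -/
theorem desc_prod_right (hl : l.IsUniversal) {Y : E} (b b' : F.obj Y) (x : H) :
    hl.desc (l.isMapCone.prod_right b b') x = x ⊓ l.rel Y b b' := by
  refine le_antisymm (le_inf ?_ ?_) (hl.le_of_forall_rel fun Z c c' h => ?_)
  · conv_lhs => rw [hl.eq_iSup_rel x]
    simp only [map_iSup, desc_rel, iSup_le_iff]
    intro X a a' h
    simpa using (rel_prod_le l (pair a b) (pair a' b')).trans (inf_le_left.trans (by simpa using h))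
  · rw [hl.eq_iSup_rel x]
    simp only [map_iSup, desc_rel, iSup_le_iff]
    intro X a a' h
    simpa using (rel_prod_le l (pair a b) (pair a' b')).trans inf_le_right
  · rw [le_inf_iff] at h
    have hd : l.rel Z c c' = l.rel (Z ⨯ Z) (pair c c) (pair c' c') := by
      rw [l.isMapCone.rel_diag, iSup_pos rfl]
    calc l.rel Z c c' = hl.desc (l.isMapCone.prod_right c c') (l.rel Z c c') := by
          rw [desc_rel, ← hd]
      _ ≤ hl.desc (l.isMapCone.prod_right c c') (l.rel Y b b') :=
          OrderHomClass.mono (hl.desc _).hom h.2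
      _ ≤ hl.desc (l.isMapCone.prod_right b b') (l.rel Z c c') := by
          rw [desc_rel, desc_rel]; exact l.isMapCone.rel_swap _ _ _ _
      _ ≤ _ := OrderHomClass.mono (hl.desc _).hom h.1

theorem rel_inf_rel (hl : l.IsUniversal) {X Y : E} (a a' : F.obj X) (b b' : F.obj Y) :
    l.rel X a a' ⊓ l.rel Y b b' = l.rel (X ⨯ Y) (pair a b) (pair a' b') := by
  rw [← hl.desc_prod_right, desc_rel]

theorem inf_sSup (hl : l.IsUniversal) (x : H) (S : Set H) : x ⊓ sSup S = ⨆ y ∈ S, x ⊓ y := by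
  refine le_antisymm (hl.le_of_forall_rel fun X a b h => ?_)
    (iSup₂_le fun y hy => inf_le_inf_left _ (le_sSup hy))
  rw [le_inf_iff] at h
  -- A generator below `sSup S` equals its meet with `sSup S`, and meeting with a generator is
  -- linear.
  rw [← inf_eq_right.2 h.2, ← hl.desc_prod_right, map_sSup]
  refine sSup_le ?_
  rintro _ ⟨y, hy, rfl⟩
  refine le_iSup₂_of_le y hy ?_
  change hl.desc (l.isMapCone.prod_right a b) y ≤ _
  rw [hl.desc_prod_right, inf_comm]
  exact inf_le_inf_right _ h.1

/-- The vertex of the universal `◇`-cone is a locale. -/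
abbrev frame (hl : l.IsUniversal) : Order.Frame H :=
  Order.Frame.ofMinimalAxioms ⟨fun x S => (hl.inf_sSup x S).le⟩

theorem rel_terminal (hl : l.IsUniversal) (s t : F.obj (⊤_ E)) : l.rel (⊤_ E) s t = ⊤ :=
  top_le_iff.1 (hl.le_of_forall_rel fun _ _ _ _ => l.isMapCone.rel_le_terminal _ _ _ _)

theorem rel_prod_self (hl : l.IsUniversal) {X : E} (a b c : F.obj X) :
    l.rel X a b ⊓ l.rel X a c = ⨆ _ : b = c, l.rel X a b := by
  rw [hl.rel_inf_rel, l.isMapCone.rel_diag]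

theorem rel_prod_self' (hl : l.IsUniversal) {X : E} (a b c : F.obj X) :
    l.rel X b a ⊓ l.rel X c a = ⨆ _ : b = c, l.rel X b a := by
  rw [hl.rel_inf_rel]
  exact l.isMapCone.swap.rel_diag a b c

theorem iSup_rel_left (hl : l.IsUniversal) {X : E} (a : F.obj X) : ⨆ y, l.rel X a y = ⊤ := by
  rw [l.isMapCone.iSup_rel_left a default default, hl.rel_terminal]

theorem iSup_rel_right (hl : l.IsUniversal) {X : E} (a : F.obj X) : ⨆ y, l.rel X y a = ⊤ :=
  (l.isMapCone.swap.iSup_rel_left a default default).trans (hl.rel_terminal _ _)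

/-- The universal `◇`-cone is a `▷`-cone of `ℓ`-bijections. -/
abbrev triangleCone (hl : l.IsUniversal) : letI := hl.frame; TriangleCone F H :=
  letI := hl.frame
  { rel := l.rel
    triangle := l.isMapCone.le_map
    bijection := fun X =>
      { ed := hl.iSup_rel_left
        uv := fun x b b' h => by rw [hl.rel_prod_self, iSup_neg h]
        su := hl.iSup_rel_right
        inj := fun a a' y h => by rw [hl.rel_prod_self', iSup_neg h] } }

end LozengeCone.IsUniversal

/-! ### Products in ▷-cones, and universality of the coend among them. -/

namespace TriangleCone

variable [IsGrothendieckTopos E] [PreservesFiniteLimits F] {G : Type u} [Order.Frame G]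

theorem rel_terminal (m : TriangleCone F G) (s t : F.obj (⊤_ E)) : m.rel (⊤_ E) s t = ⊤ := by
  rw [← m.isMapCone.iSup_rel_left s, (m.bijection _).ed]

/-- Split the meet along ⊤ = ⋁ `[X × Y,(a,b),z]`. If z differs from (a', b'), one of its projections
does, and univaluedness of that factor kills the term. -/
theorem rel_inf_rel (m : TriangleCone F G) {X Y : E} (a a' : F.obj X) (b b' : F.obj Y) :
    m.rel X a a' ⊓ m.rel Y b b' = m.rel (X ⨯ Y) (pair a b) (pair a' b') := by
  refine le_antisymm ?_ (le_inf ?_ ?_)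
  · rw [← inf_top_eq (_ ⊓ _), ← (m.bijection _).ed (pair a b), inf_iSup_eq]
    refine iSup_le fun z => ?_
    by_cases h : pair a' b' = z
    · rw [h]; exact inf_le_right
    · rw [pair_eq_iff, not_and_or] at h
      rcases h with h | h
      · refine (inf_le_inf inf_le_left (m.triangle prod.fst _ _)).trans ?_
        rw [map_fst_pair, (m.bijection X).uv _ _ _ h]
        exact bot_le
      · refine (inf_le_inf inf_le_right (m.triangle prod.snd _ _)).trans ?_
        rw [map_snd_pair, (m.bijection Y).uv _ _ _ h]
        exact bot_le
  · simpa using m.triangle (prod.fst : X ⨯ Y ⟶ X) (pair a b) (pair a' b')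
  · simpa using m.triangle (prod.snd : X ⨯ Y ⟶ Y) (pair a b) (pair a' b')

end TriangleCone

section

variable [IsGrothendieckTopos E] [PreservesFiniteLimits F] [F.PreservesEpimorphisms]
  {H : SupLat.{u}} {l : LozengeCone F H}

/-- Both lattices are distributive, so it suffices to compare meets of generators, and on both sides
these are the generators of the product. -/
theorem LozengeCone.IsUniversal.desc_inf (hl : l.IsUniversal) {K : Type u} [Order.Frame K]
    (κ : TriangleCone F K) (x y : H) :
    hl.desc (K := SupLat.of K) κ.isMapCone (x ⊓ y) =
      hl.desc (K := SupLat.of K) κ.isMapCone x ⊓ hl.desc (K := SupLat.of K) κ.isMapCone y := by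
  let _ := hl.frame
  let φ : sSupHom H K := (hl.desc (K := SupLat.of K) κ.isMapCone).hom
  have hφ : ∀ X a b, φ (l.rel X a b) = κ.rel X a b := hl.desc_rel (K := SupLat.of K) κ.isMapCone
  change φ (x ⊓ y) = φ x ⊓ φ y
  refine le_antisymm (le_inf (OrderHomClass.mono φ inf_le_left)
    (OrderHomClass.mono φ inf_le_right)) ?_
  rw [hl.eq_iSup_rel x, hl.eq_iSup_rel y]
  simp only [map_iSup, iSup_inf_eq, inf_iSup_eq, hφ, hl.rel_inf_rel, κ.rel_inf_rel, le_refl]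

/-- The universal `◇`-cone is a universal `▷`-cone of `ℓ`-bijections. -/
theorem LozengeCone.IsUniversal.triangleCone_isUniversal (hl : l.IsUniversal) :
    letI := hl.frame; hl.triangleCone.IsUniversal := by
  let _ := hl.frame
  intro K _ κ
  refine ⟨⟨⟨⟨hl.desc (K := SupLat.of K) κ.isMapCone, hl.desc_inf κ⟩, ?_⟩,
    fun S => map_sSup (hl.desc (K := SupLat.of K) κ.isMapCone).hom S⟩,
    hl.desc_rel (K := SupLat.of K) κ.isMapCone, ?_⟩
  · change hl.desc (K := SupLat.of K) κ.isMapCone (⊤ : H) = _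
    rw [← hl.rel_terminal default default, desc_rel, κ.rel_terminal]
  · intro ψ hψ
    let ψ' : H ⟶ SupLat.of K := ⟨⟨ψ, fun S => map_sSup ψ S⟩⟩
    have : ψ' = hl.desc (K := SupLat.of K) κ.isMapCone :=
      hl.hom_ext fun X a b => (hψ X a b).trans (hl.desc_rel (K := SupLat.of K) _ _ _ _).symm
    ext x
    exact congrArg (fun θ : H ⟶ SupLat.of K => θ x) this

end

/-! ## The Hopf algebra structure -/

theorem iSup_top_inf {H : Type*} [CompleteLattice H] (p : Prop) (x : H) :
    (⨆ _ : p, ⊤) ⊓ x = ⨆ _ : p, x := by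
  by_cases h : p <;> simp [h]

namespace SupLat

theorem tensorμ_tmul {A B C D : SupLat.{u}} (a : A) (b : B) (c : C) (d : D) :
    (tensorμ A B C D) ((a ⊗ₛ b) ⊗ₛ (c ⊗ₛ d)) = (a ⊗ₛ c) ⊗ₛ (b ⊗ₛ d) := by
  change (assocHom A B (tens C D) ≫ tensorMap (𝟙 A) (assocInv B C D) ≫
    tensorMap (𝟙 A) (tensorMap (swapHom B C) (𝟙 D)) ≫ tensorMap (𝟙 A) (assocHom C B D) ≫
    assocInv A C (tens B D)) ((a ⊗ₛ b) ⊗ₛ (c ⊗ₛ d)) = _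
  simp only [comp_apply, assocHom_tmul, tensorMap_tmul, id_apply, assocInv_tmul, swapHom_tmul]

theorem mem_iSup_two {I : Sort*} (p : I → two.{u}) (x : PUnit) :
    x ∈ (⨆ i, p i : Set PUnit) ↔ ∃ i, x ∈ (p i : Set PUnit) := Set.mem_iUnion

theorem iSup_truth {I : Sort*} (p : I → Prop) : ⨆ i, truth.{u} (p i) = truth (∃ i, p i) :=
  Set.ext fun _ => mem_iSup_two _ _

theorem truth_eq_iSup (p : Prop) : truth.{u} p = ⨆ _ : p, ⊤ := by
  rw [show (⊤ : two.{u}) = truth True from (Set.ext fun _ => by simp [truth]), iSup_truth]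
  simp

theorem map_truth {A : SupLat.{u}} (f : two ⟶ A) (p : Prop) : f (truth p) = ⨆ _ : p, f ⊤ := by
  rw [truth_eq_iSup, map_iSup]

theorem truth_tmul {A : SupLat.{u}} (p : Prop) (a : A) :
    truth p ⊗ₛ a = ⨆ _ : p, (⊤ : two) ⊗ₛ a := by
  rw [truth_eq_iSup, tmul_iSup_left]

theorem tmul_truth {A : SupLat.{u}} (p : Prop) (a : A) :
    a ⊗ₛ truth p = ⨆ _ : p, a ⊗ₛ (⊤ : two) := by
  rw [truth_eq_iSup, tmul_iSup_right]

theorem two_hom_ext {A : SupLat.{u}} {f g : two ⟶ A} (h : f ⊤ = g ⊤) : f = g := by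
  refine hom_ext fun p => ?_
  rcases two_cases p with rfl | rfl
  · exact h
  · exact (map_bot f.hom).trans (map_bot g.hom).symm

/-- The map `2 ⟶ A` which sends `1` to a given element. -/
def ofElement {A : SupLat.{u}} (a : A) : two ⟶ A :=
  ⟨⟨fun p => ⨆ _ : PUnit.unit ∈ (p : Set PUnit), a, fun S => eq_of_forall_ge_iff fun b => by
    simp⟩⟩

theorem ofElement_apply {A : SupLat.{u}} (a : A) (p : two) :
    ofElement a p = ⨆ _ : PUnit.unit ∈ (p : Set PUnit), a := rfl

theorem ofElement_top {A : SupLat.{u}} (a : A) : ofElement a ⊤ = a :=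
  iSup_pos (Set.mem_univ PUnit.unit)

end SupLat


/-- Expanding the left factor along f replaces the middle element of FY by some f(y). Expanding the
right factor then moves the middle element to y in FX and leaves a supremum over the fibre of b. -/
theorem IsMapCone.comul {H : SupLat.{u}} {r : ∀ X : E, F.obj X → F.obj X → H}
    (hr : IsMapCone r) : IsMapCone (H := SupLat.tens H H) fun X a b => ⨆ x, r X a x ⊗ₛ r X x b := by
  constructor
  · intro X Y f a b
    simp only [hr.map_left f a, SupLat.tmul_iSup_left]
    rw [iSup_comm]
    simp only [iSup_iSup_eq_right, hr.map_left, SupLat.tmul_iSup_right]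
    rw [iSup_comm]
    exact iSup_congr fun _ => iSup_comm
  · intro X Y f a b
    simp only [hr.map_right f _ b, SupLat.tmul_iSup_right]
    rw [iSup_comm]
    simp only [iSup_iSup_eq_right, hr.map_right, SupLat.tmul_iSup_left]
    rw [iSup_comm]
    exact iSup_congr fun _ => iSup_comm

theorem isMapCone_truth : IsMapCone (H := SupLat.two)
    fun (X : E) (a b : F.obj X) => SupLat.truth (a = b) :=
  ⟨fun f a b => Set.ext fun _ => by simp [SupLat.truth],
    fun f a b => Set.ext fun _ => by simp [SupLat.truth, eq_comm]⟩

theorem SupLat.hopfObj_ext {A : SupLat.{u}} {h k : HopfObj A}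
    (mul : h.mul = k.mul) (one : h.one = k.one) (comul : h.comul = k.comul)
    (counit : h.counit = k.counit) (antipode : h.antipode = k.antipode) : h = k := by
  rcases h with @⟨@⟨⟨_, _, _, _, _⟩, ⟨_, _, _, _, _⟩, _, _, _, _⟩, _, _, _⟩
  rcases k with @⟨@⟨⟨_, _, _, _, _⟩, ⟨_, _, _, _, _⟩, _, _, _, _⟩, _, _, _⟩
  cases mul
  cases one
  cases comul
  cases counit
  cases antipode
  rfl

namespace LozengeCone.IsUniversal

variable [IsGrothendieckTopos E] [PreservesFiniteLimits F] [F.PreservesEpimorphisms]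
  {H : SupLat.{u}} {l : LozengeCone F H}

theorem isBilinear_inf (hl : l.IsUniversal) : IsBilinear fun x y : H => x ⊓ y :=
  ⟨fun S y => by simp only [inf_comm _ y, hl.inf_sSup], hl.inf_sSup⟩

/-- The multiplication `x ⊗ y ↦ x ⊓ y`. -/
def infHom (hl : l.IsUniversal) : SupLat.tens H H ⟶ H := SupLat.tensorDesc _ hl.isBilinear_inf

theorem infHom_tmul (hl : l.IsUniversal) (x y : H) : hl.infHom (x ⊗ₛ y) = x ⊓ y :=
  SupLat.tensorDesc_tmul _ _ _ _

/-- The comultiplication. -/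
def comul (hl : l.IsUniversal) : H ⟶ SupLat.tens H H := hl.desc l.isMapCone.comul

theorem comul_rel (hl : l.IsUniversal) (X : E) (a b : F.obj X) :
    hl.comul (l.rel X a b) = ⨆ x : F.obj X, l.rel X a x ⊗ₛ l.rel X x b := hl.desc_rel _ _ _ _

/-- The counit. -/
def counit (hl : l.IsUniversal) : H ⟶ SupLat.two := hl.desc isMapCone_truth

theorem counit_rel (hl : l.IsUniversal) (X : E) (a b : F.obj X) :
    hl.counit (l.rel X a b) = SupLat.truth (a = b) := hl.desc_rel _ _ _ _

/-- The antipode. -/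
def antipode (hl : l.IsUniversal) : H ⟶ H := hl.desc l.isMapCone.swap

theorem antipode_rel (hl : l.IsUniversal) (X : E) (a b : F.obj X) :
    hl.antipode (l.rel X a b) = l.rel X b a := hl.desc_rel _ _ _ _

/-- The algebra structure. -/
abbrev monObj (hl : l.IsUniversal) : MonObj H where
  one := SupLat.ofElement ⊤
  mul := hl.infHom
  one_mul := by
    change SupLat.tensorMap (SupLat.ofElement ⊤) (𝟙 H) ≫ hl.infHom = SupLat.unitHom H
    refine SupLat.tensor_ext fun p x => ?_
    rw [SupLat.comp_apply, SupLat.tensorMap_tmul, infHom_tmul, SupLat.unitHom_tmul, SupLat.id_apply,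
      SupLat.ofElement_apply, iSup_top_inf]
  mul_one := by
    change SupLat.tensorMap (𝟙 H) (SupLat.ofElement ⊤) ≫ hl.infHom =
      SupLat.swapHom H SupLat.two ≫ SupLat.unitHom H
    refine SupLat.tensor_ext fun x p => ?_
    rw [SupLat.comp_apply, SupLat.comp_apply, SupLat.swapHom_tmul, SupLat.tensorMap_tmul,
      infHom_tmul, SupLat.unitHom_tmul, SupLat.id_apply, SupLat.ofElement_apply, inf_comm,
      iSup_top_inf]
  mul_assoc := by
    change SupLat.tensorMap hl.infHom (𝟙 H) ≫ hl.infHom =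
      SupLat.assocHom H H H ≫ SupLat.tensorMap (𝟙 H) hl.infHom ≫ hl.infHom
    refine SupLat.tensor_ext_left fun x y z => ?_
    simp only [SupLat.comp_apply, SupLat.tensorMap_tmul, SupLat.assocHom_tmul, infHom_tmul,
      SupLat.id_apply, inf_assoc]

/-- The coalgebra structure. -/
abbrev comonObj (hl : l.IsUniversal) : ComonObj H where
  counit := hl.counit
  comul := hl.comul
  counit_comul := by
    change hl.comul ≫ SupLat.tensorMap hl.counit (𝟙 H) = SupLat.unitInv H
    refine hl.hom_ext fun X a b => ?_
    rw [SupLat.comp_apply, comul_rel, map_iSup, SupLat.unitInv_apply]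
    refine Eq.trans (b := ⨆ x, ⨆ _ : a = x, (⊤ : SupLat.two) ⊗ₛ l.rel X x b)
      (iSup_congr fun x => ?_) iSup_iSup_eq_right
    rw [SupLat.tensorMap_tmul, counit_rel, SupLat.truth_tmul, SupLat.id_apply]
  comul_counit := by
    change hl.comul ≫ SupLat.tensorMap (𝟙 H) hl.counit =
      SupLat.unitInv H ≫ SupLat.swapHom SupLat.two H
    refine hl.hom_ext fun X a b => ?_
    rw [SupLat.comp_apply, comul_rel, map_iSup, SupLat.comp_apply, SupLat.unitInv_apply,
      SupLat.swapHom_tmul]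
    refine Eq.trans (b := ⨆ x, ⨆ _ : x = b, l.rel X a x ⊗ₛ (⊤ : SupLat.two))
      (iSup_congr fun x => ?_) iSup_iSup_eq_left
    rw [SupLat.tensorMap_tmul, counit_rel, SupLat.tmul_truth, SupLat.id_apply]
  comul_assoc := by
    change hl.comul ≫ SupLat.tensorMap (𝟙 H) hl.comul =
      hl.comul ≫ SupLat.tensorMap hl.comul (𝟙 H) ≫ SupLat.assocHom H H H
    refine hl.hom_ext fun X a b => ?_
    rw [SupLat.comp_apply, SupLat.comp_apply, SupLat.comp_apply, comul_rel, map_iSup, map_iSup, map_iSup]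
    simp only [SupLat.tensorMap_tmul, comul_rel, SupLat.id_apply, map_iSup, SupLat.tmul_iSup_left,
      SupLat.tmul_iSup_right, SupLat.assocHom_tmul]
    exact iSup_comm

/-- The bialgebra structure. -/
abbrev bimonObj (hl : l.IsUniversal) : BimonObj H where
  toMonObj := hl.monObj
  toComonObj := hl.comonObj
  mul_comul := by
    change hl.infHom ≫ hl.comul = SupLat.tensorMap hl.comul hl.comul ≫ tensorμ H H H H ≫
      SupLat.tensorMap hl.infHom hl.infHom
    refine hl.tensor_ext fun X a a' Y b b' => ?_
    rw [SupLat.comp_apply, SupLat.comp_apply, SupLat.comp_apply, infHom_tmul, hl.rel_inf_rel,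
      -- The middle element of F(X × Y) is a pair, so the single supremum becomes the double one of
      -- the right-hand side.
      comul_rel, SupLat.tensorMap_tmul, comul_rel, comul_rel, SupLat.iSup_tmul_iSup,
      ← (pairEquiv X Y).iSup_comp, iSup_prod]
    simp only [map_iSup]
    refine iSup_congr fun x => iSup_congr fun y => ?_
    refine Eq.trans ?_ (congrArg (SupLat.tensorMap hl.infHom hl.infHom)
      (SupLat.tensorμ_tmul _ _ _ _).symm)
    rw [SupLat.tensorMap_tmul, infHom_tmul, infHom_tmul, hl.rel_inf_rel, hl.rel_inf_rel]
    rfl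
  one_comul := by
    change SupLat.ofElement ⊤ ≫ hl.comul = SupLat.unitInv SupLat.two ≫
      SupLat.tensorMap (SupLat.ofElement ⊤) (SupLat.ofElement ⊤)
    refine SupLat.two_hom_ext ?_
    rw [SupLat.comp_apply, SupLat.comp_apply, SupLat.unitInv_apply, SupLat.tensorMap_tmul,
      SupLat.ofElement_top, ← hl.rel_terminal default default, comul_rel]
    exact iSup_unique (f := fun x => l.rel (⊤_ E) default x ⊗ₛ l.rel (⊤_ E) x default)
  mul_counit := by
    change hl.infHom ≫ hl.counit = SupLat.tensorMap hl.counit hl.counit ≫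
      SupLat.unitHom SupLat.two
    refine hl.tensor_ext fun X a a' Y b b' => ?_
    rw [SupLat.comp_apply, SupLat.comp_apply, infHom_tmul, hl.rel_inf_rel,
      counit_rel, SupLat.tensorMap_tmul, counit_rel, counit_rel, SupLat.unitHom_tmul, pair_eq_iff,
      map_fst_pair, map_snd_pair]
    refine Eq.trans ?_ (SupLat.iSup_truth _).symm
    simp [SupLat.truth]
  one_counit := by
    change SupLat.ofElement ⊤ ≫ hl.counit = 𝟙 SupLat.two
    refine SupLat.two_hom_ext ?_
    rw [SupLat.comp_apply, SupLat.ofElement_top, ← hl.rel_terminal default default, counit_rel,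
      SupLat.id_apply]
    exact Set.ext fun _ => by simp [SupLat.truth]

/-- The Hopf algebra structure. -/
abbrev hopfObj (hl : l.IsUniversal) : HopfObj H where
  toBimonObj := hl.bimonObj
  antipode := hl.antipode
  antipode_left := by
    change hl.comul ≫ SupLat.tensorMap hl.antipode (𝟙 H) ≫ hl.infHom =
      hl.counit ≫ SupLat.ofElement ⊤
    refine hl.hom_ext fun X a b => ?_
    rw [SupLat.comp_apply, SupLat.comp_apply, SupLat.comp_apply, comul_rel, counit_rel,
      SupLat.map_truth, SupLat.ofElement_top, map_iSup, map_iSup]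
    -- The terms are now `[X,x,a]` ∧ `[X,x,b]`: univaluedness leaves only a = b, and then
    -- surjectivity makes the supremum over x equal to ⊤. The right antipode law uses injectivity
    -- and totality instead.
    simp only [SupLat.tensorMap_tmul, antipode_rel, infHom_tmul, SupLat.id_apply, rel_prod_self hl]
    rw [iSup_comm]
    exact iSup_congr fun _ => hl.iSup_rel_right a
  antipode_right := by
    change hl.comul ≫ SupLat.tensorMap (𝟙 H) hl.antipode ≫ hl.infHom =
      hl.counit ≫ SupLat.ofElement ⊤
    refine hl.hom_ext fun X a b => ?_
    rw [SupLat.comp_apply, SupLat.comp_apply, SupLat.comp_apply, comul_rel, counit_rel,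
      SupLat.map_truth, SupLat.ofElement_top, map_iSup, map_iSup]
    simp only [SupLat.tensorMap_tmul, antipode_rel, infHom_tmul, SupLat.id_apply, rel_prod_self' hl]
    rw [iSup_comm]
    exact iSup_congr fun _ => hl.iSup_rel_left a

theorem hopfObj_isTannakaHopf (hl : l.IsUniversal) : l.IsTannakaHopf hl.hopfObj where
  comul := hl.comul_rel
  counit := hl.counit_rel
  antipode := hl.antipode_rel
  mul X Y z z' := (hl.infHom_tmul _ _).trans (by rw [hl.rel_inf_rel, pair_eta, pair_eta])
  one s s' := (SupLat.ofElement_top _).trans (hl.rel_terminal s s').symm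

/-- The Tannakian product and the meet are both linear on H ⊗ H and have the same value on pairs of
generators, so they coincide; the unit `[1,*,*]` is the top element. -/
theorem isLocalicGroup (hl : l.IsUniversal) {h : HopfObj H} (hh : l.IsTannakaHopf h) :
    IsLocalicGroup H h where
  inf_sSup := hl.inf_sSup
  mul a b := by
    have e : μ[H] = hl.infHom := hl.tensor_ext fun X a a' Y b b' => by
      rw [hl.infHom_tmul, hl.rel_inf_rel, ← hh.mul]
      simp
    rw [e, hl.infHom_tmul]
  one := (hh.one default default).trans (hl.rel_terminal _ _)

/-- A localic group structure is determined by its values on the elements of the cone. -/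
theorem hopfObj_unique (hl : l.IsUniversal) {h k : HopfObj H} (hh : IsLocalicGroup H h)
    (hk : IsLocalicGroup H k) (hh' : HasConeCogroup l.rel h) (hk' : HasConeCogroup l.rel k) :
    h = k := by
  refine SupLat.hopfObj_ext ?_ ?_ ?_ ?_ ?_
  · exact SupLat.tensor_ext fun a b => (hh.mul a b).trans (hk.mul a b).symm
  · exact SupLat.two_hom_ext (hh.one.trans hk.one.symm)
  · exact hl.hom_ext fun X a b => (hh'.comul X a b).trans (hk'.comul X a b).symm
  · exact hl.hom_ext fun X a b => (hh'.counit X a b).trans (hk'.counit X a b).symm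
  · exact hl.hom_ext fun X a b => (hh'.antipode X a b).trans (hk'.antipode X a b).symm

end LozengeCone.IsUniversal

/-! ## The comparison of the two universal cones -/

/-- A frame homomorphism preserves suprema, finite meets, ⊤ and ⊥, so the image of a ▷-cone of
ℓ-bijections is another one and uniqueness applies to it. -/
theorem TriangleCone.IsUniversal.hom_ext [IsGrothendieckTopos E] {G K : Type u}
    [Order.Frame G] [Order.Frame K]
    {m : TriangleCone F G} (hm : m.IsUniversal) {φ ψ : FrameHom G K}
    (h : ∀ X a b, φ (m.rel X a b) = ψ (m.rel X a b)) : φ = ψ :=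
  (hm K
    { rel := fun X a b => ψ (m.rel X a b)
      triangle := fun f a b => OrderHomClass.mono ψ (m.triangle f a b)
      bijection := fun X =>
        { ed := fun a => by rw [← map_iSup, (m.bijection X).ed, map_top]
          uv := fun x b b' h => by rw [← map_inf, (m.bijection X).uv x b b' h, map_bot]
          su := fun a => by rw [← map_iSup, (m.bijection X).su, map_top]
          inj := fun a a' y h => by
            rw [← map_inf, (m.bijection X).inj a a' y h, map_bot] } }).unique h fun _ _ _ => rfl

section Comparison

variable [IsGrothendieckTopos E] [PreservesFiniteLimits F] [F.PreservesEpimorphisms]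

theorem LozengeCone.IsUniversal.exists_triangleCone {H : SupLat.{u}} {l : LozengeCone F H}
    (hl : l.IsUniversal) :
    ∃ (G : Type u) (_ : Order.Frame G) (m : TriangleCone F G), m.IsUniversal :=
  ⟨H, hl.frame, hl.triangleCone, hl.triangleCone_isUniversal⟩

/-- The comparison isomorphism between the vertices of the two universal cones. -/
theorem LozengeCone.IsUniversal.exists_iso {H : SupLat.{u}} {l : LozengeCone F H}
    (hl : l.IsUniversal) {G : Type u} [Order.Frame G] {m : TriangleCone F G}
    (hm : m.IsUniversal) :
    ∃ φ : H ≅ SupLat.of G, ∀ (X : E) (a b : F.obj X), φ.hom (l.rel X a b) = m.rel X a b := by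
  let _ := hl.frame
  obtain ⟨φ, hφ, -⟩ := hl.triangleCone_isUniversal G m
  obtain ⟨ψ, hψ, -⟩ := hm H hl.triangleCone
  have h1 : ψ.comp φ = FrameHom.id H := hl.triangleCone_isUniversal.hom_ext fun X a b => by
    change ψ (φ _) = _
    rw [hφ, hψ]
    rfl
  have h2 : φ.comp ψ = FrameHom.id G := hm.hom_ext fun X a b => by
    change φ (ψ _) = _
    rw [hψ, hφ]
    rfl
  exact ⟨⟨⟨⟨φ, fun S => map_sSup φ S⟩⟩, ⟨⟨ψ, fun S => map_sSup ψ S⟩⟩,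
    SupLat.hom_ext fun x => DFunLike.congr_fun h1 x,
    SupLat.hom_ext fun x => DFunLike.congr_fun h2 x⟩, hφ⟩

/-- The universal `▷`-cone of `ℓ`-bijections is a universal `◇`-cone. -/
theorem LozengeCone.IsUniversal.of_triangleCone {H : SupLat.{u}} {l : LozengeCone F H}
    (hl : l.IsUniversal) {G : Type u} [Order.Frame G] {m : TriangleCone F G}
    (hm : m.IsUniversal) :
    LozengeCone.IsUniversal (H := SupLat.of G) m.isMapCone.lozengeCone := by
  obtain ⟨φ, hφ⟩ := hl.exists_iso hm
  intro K κ
  refine ⟨φ.inv ≫ hl.desc κ.isMapCone, fun X a b => ?_, fun ψ hψ => ?_⟩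
  · have : φ.inv (m.rel X a b) = l.rel X a b := by
      rw [← hφ, ← SupLat.comp_apply, φ.hom_inv_id, SupLat.id_apply]
    exact (congrArg (hl.desc κ.isMapCone) this).trans (hl.desc_rel _ _ _ _)
  · rw [Iso.eq_inv_comp]
    refine hl.hom_ext fun X a b => ?_
    rw [SupLat.comp_apply, hφ, hl.desc_rel]
    exact hψ X a b

/-- A linear map between localic groups which commutes with `⊓`, `⊤` and with the cones is a map of
bialgebras. -/
theorem LozengeCone.IsUniversal.isBimonHom {H K : SupLat.{u}} {l : LozengeCone F H}
    (hl : l.IsUniversal) {κ : LozengeCone F K} (hκ : κ.IsUniversal)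
    {h : HopfObj H} {k : HopfObj K} (hh : IsLocalicGroup H h) (hk : IsLocalicGroup K k)
    (hh' : HasConeCogroup l.rel h) (hk' : HasConeCogroup κ.rel k) {φ : H ⟶ K}
    (hφ : ∀ (X : E) (a b : F.obj X), φ (l.rel X a b) = κ.rel X a b) : IsBimonHom φ where
  one_hom := SupLat.two_hom_ext <| by
    rw [SupLat.comp_apply, hh.one, hk.one, ← hl.rel_terminal default default, hφ,
      hκ.rel_terminal]
  mul_hom := by
    change μ[H] ≫ φ = SupLat.tensorMap φ φ ≫ μ[K]
    refine hl.tensor_ext fun X a b Y c d => ?_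
    rw [SupLat.comp_apply, SupLat.comp_apply, SupLat.tensorMap_tmul, hh.mul, hk.mul,
      hl.rel_inf_rel, hφ, hφ, hφ, hκ.rel_inf_rel]
  hom_counit := hl.hom_ext fun X a b => by
    rw [SupLat.comp_apply, hφ, hh'.counit, hk'.counit]
  hom_comul := by
    change φ ≫ Δ[K] = Δ[H] ≫ SupLat.tensorMap φ φ
    refine hl.hom_ext fun X a b => ?_
    rw [SupLat.comp_apply, SupLat.comp_apply, hφ, hh'.comul, hk'.comul]
    refine Eq.trans ?_ (map_iSup (SupLat.tensorMap φ φ).hom _).symm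
    exact iSup_congr fun x => by rw [SupLat.tensorMap_tmul, hφ, hφ]

end Comparison

end

theorem mainTheorem10 {E : Type w} [Category.{u} E] [IsGrothendieckTopos E] (F : E ⥤ Type u)
    [PreservesFiniteLimits F] [F.IsLeftAdjoint] :
    (∃ (H : SupLat.{u}) (l : LozengeCone F H), l.IsUniversal) ∧
    (∃ (G : Type u) (_ : Order.Frame G) (m : TriangleCone F G), m.IsUniversal) ∧
    ∀ (H : SupLat.{u}) (l : LozengeCone F H), l.IsUniversal →
    ∀ (G : Type u) [Order.Frame G] (m : TriangleCone F G), m.IsUniversal →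
      (∃! h : HopfObj H, l.IsTannakaHopf h) ∧
      (∃! k : HopfObj (SupLat.of G), m.IsAutGroup k) ∧
      ∀ (h : HopfObj H) (k : HopfObj (SupLat.of G)), l.IsTannakaHopf h → m.IsAutGroup k →
        IsLocalicGroup H h ∧
        ∃! φ : H ≅ SupLat.of G, IsBimonHom φ.hom ∧
          ∀ (X : E) (a b : F.obj X), φ.hom (l.rel X a b) = m.rel X a b := by
  obtain ⟨H₀, l₀, hl₀⟩ := exists_lozengeCone_isUniversal F
  refine ⟨⟨H₀, l₀, hl₀⟩, hl₀.exists_triangleCone, fun H l hl G _ m hm => ?_⟩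
  -- With G now universal among ◇-cones, the Hopf structure and its uniqueness are obtained for G
  -- from the same results as for H.
  have hm' := hl.of_triangleCone hm
  have hk := hm'.hopfObj_isTannakaHopf
  refine ⟨⟨hl.hopfObj, hl.hopfObj_isTannakaHopf, fun h hh => ?_⟩,
    ⟨hm'.hopfObj, ⟨hk.toHasConeCogroup, hm'.isLocalicGroup hk⟩, fun k hk' => ?_⟩,
    fun h k hh hk' => ⟨hl.isLocalicGroup hh, ?_⟩⟩
  · exact hl.hopfObj_unique (hl.isLocalicGroup hh) (hl.isLocalicGroup hl.hopfObj_isTannakaHopf)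
      hh.toHasConeCogroup hl.hopfObj_isTannakaHopf.toHasConeCogroup
  · exact hm'.hopfObj_unique hk'.toIsLocalicGroup (hm'.isLocalicGroup hk)
      hk'.toHasConeCogroup hk.toHasConeCogroup
  · obtain ⟨φ, hφ⟩ := hl.exists_iso hm
    -- Uniqueness needs only the values on the cone: these already determine a linear map out of H.
    refine ⟨φ, ⟨hl.isBimonHom hm' (hl.isLocalicGroup hh) hk'.toIsLocalicGroup hh.toHasConeCogroup
      hk'.toHasConeCogroup hφ, hφ⟩, fun ψ hψ => Iso.ext (hl.hom_ext fun X a b => ?_)⟩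
    rw [hψ.2, hφ]
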